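/- Notation. For positive integers $n,d$ identify $(\mathbb{R}^n)^{\otimes d}$ with $\mathbb{R}^{n^d}$ with its Euclidean inner product, let $\mathrm{Sym}^d(\mathbb{R}^n)\subseteq(\mathbb{R}^n)^{\otimes d}$ be the subspace of symmetric tensors (of dimension $\binom{n+d-1}{d}$) and let $\mathrm{Sym}_d:(\mathbb{R}^n)^{\otimes d}\to\mathrm{Sym}^d(\mathbb{R}^n)$ be the orthogonal projection onto it. For an $n\times m$ matrix $V$ with columns $v_1,\dots,v_m$, let $V^{\circledast d}$ be the matrix whose $\binom{m+d-1}{d}$ columns are $$\mathrm{Sym}_d(v_{i_1}\otimes v_{i_2}\otimes\cdots\otimes v_{i_d}),\qquad 1\le i_1\le i_2\le\cdots\le i_d\le m.$$ A $\rho$-perturbation of $U\in\mathbb{R}^{n\times m}$ is the random matrix $\tilde U=U+Z$, where the entries of $Z$ are independent $\mathcal N(0,\rho^2)$ random variables. Let $\sigma_k$ denote the $k$-th largest singular value. Theorem. There is an absolute constant $C_0\in\mathbb{N}$, for every integer $d\ge 1$ a constant $c_d>0$, and for every $d\ge1$ and $\delta>0$ a constant $\kappa_{d,\delta}>0$, such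 that the following holds. Let $n,m\ge 1$ be integers with $m\le c_d\,\delta\, n$, let $\rho>0$, let $\Phi$ be an orthogonal projection on $\mathrm{Sym}^d(\mathbb{R}^n)$ of rank $R\ge\delta\binom{n+d-1}{d}$, let $U\in\mathbb{R}^{n\times m}$ be an arbitrary matrix, and let $\tilde U$ be a $\rho$-perturbation of $U$. Then $$\Pr\left[\sigma_{\binom{m+d-1}{d}}\big(\Phi\,\tilde U^{\circledast d}\big)\ \ge\ \frac{\rho^d}{n^{C_0 d}}\right]\ \ge\ 1-\exp(-\kappa_{d,\delta}\,n).$$ -/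

import Mathlib

open MeasureTheory ProbabilityTheory

noncomputable section

/-- The tensor space `(ℝⁿ)^{⊗d} ≅ ℝ^{n^d}`, a tensor being given by its `n × ⋯ × n` array of
entries, with the Euclidean (Frobenius) inner product. -/
abbrev TensorSpace (n d : ℕ) : Type := EuclideanSpace ℝ (Fin d → Fin n)

/-- The pure tensor `v₁ ⊗ ⋯ ⊗ v_d`. -/
def pureTensor {n d : ℕ} (v : Fin d → Fin n → ℝ) : TensorSpace n d :=
  WithLp.toLp 2 fun j => ∏ k, v k (j k)

/-- The symmetric subspace `Sym^d(ℝⁿ)`: tensors invariant under all permutations of the modes. -/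
def SymTensor (n d : ℕ) : Submodule ℝ (TensorSpace n d) where
  carrier := {T | ∀ (π : Equiv.Perm (Fin d)) (j : Fin d → Fin n), T (j ∘ π) = T j}
  add_mem' := by
    intro S T hS hT π j
    simp [hS π j, hT π j]
  zero_mem' := by
    intro π j
    simp
  smul_mem' := by
    intro c T hT π j
    simp [hT π j]

/-- The orthogonal projection `Sym_d : (ℝⁿ)^{⊗d} → Sym^d(ℝⁿ)`. -/
def symProj (n d : ℕ) : TensorSpace n d →ₗ[ℝ] SymTensor n d :=
  (SymTensor n d).orthogonalProjectionOnto.toLinearMap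

/-- The index set of tuples `i₁ ≤ i₂ ≤ ⋯ ≤ i_d` in `{1, …, m}`. -/
abbrev MonoTuple (m d : ℕ) : Type := {i : Fin d → Fin m // Monotone i}

instance (m d : ℕ) : Fintype (MonoTuple m d) := Fintype.ofFinite _

/-- The column of `U^{⊛d}` with index `i₁ ≤ ⋯ ≤ i_d`, namely `Sym_d(u_{i₁} ⊗ ⋯ ⊗ u_{i_d})`,
where `u_i` is the `i`-th column of `U`. -/
def symKroneckerColumn {n m : ℕ} (d : ℕ) (U : Matrix (Fin n) (Fin m) ℝ) (i : MonoTuple m d) :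
    SymTensor n d :=
  symProj n d (pureTensor fun k => U.col (i.1 k))

/-- The symmetrized Kronecker power `U^{⊛d}`, as the linear map
`α ↦ ∑ α_i Sym_d(u_{i₁} ⊗ ⋯ ⊗ u_{i_d})` on Euclidean space. -/
def symKronecker {n m : ℕ} (d : ℕ) (U : Matrix (Fin n) (Fin m) ℝ) :
    EuclideanSpace ℝ (MonoTuple m d) →ₗ[ℝ] SymTensor n d where
  toFun α := ∑ i, α i • symKroneckerColumn d U i
  map_add' := by
    intro α β
    simp [add_smul, Finset.sum_add_distrib]
  map_smul' := by
    intro c α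
    simp [mul_smul, Finset.smul_sum]

/-- The law of an `n × m` random matrix with independent `N(0, ρ²)` entries. -/
def gaussianNoise (n m : ℕ) (ρ : ℝ) : Measure (Fin n → Fin m → ℝ) :=
  Measure.pi fun _ => Measure.pi fun _ => gaussianReal 0 ⟨ρ ^ 2, sq_nonneg ρ⟩

/-- The `k`-th largest singular value `σ_k(T)`, for `k ≥ 1` (Mathlib counts from zero). -/
def sigma {E F : Type*} [NormedAddCommGroup E] [InnerProductSpace ℝ E] [FiniteDimensional ℝ E]
    [NormedAddCommGroup F] [InnerProductSpace ℝ F] [FiniteDimensional ℝ F]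
    (k : ℕ) (T : E →ₗ[ℝ] F) : ℝ :=
  T.singularValues (k - 1)

end

/-! A small singular value yields coefficients `x J`, all of modulus at most 1 and with `x I = 1`
for some `I`, whose combination of columns is nearly orthogonal to `W`, the range of `Φ`. Fix `I`
and condition on the Gaussian columns outside `I`. Test only against those `T ∈ W` whose
contractions with all columns of `U` and all conditioned Gaussian columns vanish; this costs at most
`2 m n^(d-1)` dimensions. For such `T` the shift `U` drops out and only tuples `J` drawn from the
columns of `I` survive. There are at most `d^d` of these, so a net of size polynomial in `n` covers
their coefficients (`nearDependentSet_real_le`).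

For fixed coefficients `f`, the core is the anticoncentration of `Z^{⊗d} f` in a large subspace
(`smallProjSet_real_le`), by induction on `d`. Some coordinate slice `a` is bounded below on a
subspace of `W` of proportion `1/(2n)`. The derivative of `⟨T, Z^{⊗d} f⟩` in the entry `Z (a, c)` is
`d` times the pairing of the slice of `T` with a power of order `d - 1`, so by induction it is large
for some `T`. A polynomial with large derivative is rarely small, so the randomness of this single
entry gains a factor `q`. Tensors of `W` with vanishing slice `a` do not involve that entry and form
a subspace of codimension at most `n^(d-1)`, so the gain can be repeated `k ≈ δ n` times. As `q` is
a negative power of `n` up to a constant, `q ^ k` beats the net and the union over `I`. -/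

/-! ### Conditioning in product measures -/

theorem measurePreserving_piecewise {κ : Type*} [Fintype κ] (μ : κ → Measure ℝ)
    [∀ i, IsProbabilityMeasure (μ i)] (s : Set κ) [∀ i, Decidable (i ∈ s)] :
    MeasurePreserving (fun p : (κ → ℝ) × (κ → ℝ) => s.piecewise p.1 p.2)
      ((Measure.pi μ).prod (Measure.pi μ)) (Measure.pi μ) := by
  have hm : Measurable (fun p : (κ → ℝ) × (κ → ℝ) => s.piecewise p.1 p.2) := by
    refine measurable_pi_lambda _ fun i => ?_
    by_cases h : i ∈ s
    · simp only [Set.piecewise, h, if_true]; fun_prop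
    · simp only [Set.piecewise, h, if_false]; fun_prop
  refine ⟨hm, ?_⟩
  refine (Measure.pi_eq fun t ht => ?_).symm
  rw [Measure.map_apply hm (MeasurableSet.univ_pi ht)]
  have : (fun p : (κ → ℝ) × (κ → ℝ) => s.piecewise p.1 p.2) ⁻¹' (Set.univ.pi t) =
      (Set.univ.pi fun i => if i ∈ s then t i else Set.univ) ×ˢ
        (Set.univ.pi fun i => if i ∈ s then Set.univ else t i) := by
    ext p
    simp only [Set.mem_preimage, Set.mem_univ_pi, Set.mem_prod, ← forall_and]
    refine forall_congr' fun i => ?_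
    by_cases h : i ∈ s <;> simp [Set.piecewise, h]
  rw [this, Measure.prod_prod, Measure.pi_pi, Measure.pi_pi, ← Finset.prod_mul_distrib]
  refine Finset.prod_congr rfl fun i _ => ?_
  by_cases h : i ∈ s <;> simp [h]

/-- Conditioning on the coordinates outside `s`. -/
theorem pi_real_le_of_slices {κ : Type*} [Fintype κ] (μ : κ → Measure ℝ)
    [∀ i, IsProbabilityMeasure (μ i)] (s : Set κ) [∀ i, Decidable (i ∈ s)]
    {B S : Set (κ → ℝ)} (hB : MeasurableSet B) (hS : MeasurableSet S) (hBS : B ⊆ S)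
    (hinv : ∀ x y, s.piecewise x y ∈ S → y ∈ S) {q : ℝ} (hq : 0 ≤ q)
    (h : ∀ y, (Measure.pi μ).real {x | s.piecewise x y ∈ B} ≤ q) :
    (Measure.pi μ).real B ≤ q * (Measure.pi μ).real S := by
  have hp := measurePreserving_piecewise μ s
  have h1 : Measure.pi μ B ≤ ENNReal.ofReal q * Measure.pi μ S := by
    rw [← hp.measure_preimage hB.nullMeasurableSet,
      Measure.prod_apply_symm (hp.measurable hB), ← lintegral_indicator_const hS]
    refine lintegral_mono fun y => ?_
    by_cases hy : y ∈ S
    · rw [Set.indicator_of_mem hy]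
      refine (ENNReal.le_ofReal_iff_toReal_le (measure_ne_top _ _) hq).2 ?_
      exact h y
    · rw [Set.indicator_of_notMem hy]
      have : (fun x => (x, y)) ⁻¹' ((fun p : (κ → ℝ) × (κ → ℝ) => s.piecewise p.1 p.2) ⁻¹' B)
          = ∅ := by
        ext x
        simp only [Set.mem_preimage, Set.mem_empty_iff_false, iff_false]
        exact fun hx => hy (hinv x y (hBS hx))
      rw [this, measure_empty]
  have h2 := ENNReal.toReal_mono (ENNReal.mul_ne_top ENNReal.ofReal_ne_top
    (measure_ne_top _ _)) h1
  rwa [ENNReal.toReal_mul, ENNReal.toReal_ofReal hq] at h2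

/-- Conditioning on all coordinates but one. -/
theorem pi_real_le_of_update {κ : Type*} [Fintype κ] [DecidableEq κ] (μ : κ → Measure ℝ)
    [∀ i, IsProbabilityMeasure (μ i)] (i : κ)
    {B S : Set (κ → ℝ)} (hB : MeasurableSet B) (hS : MeasurableSet S) (hBS : B ⊆ S)
    (hinv : ∀ y t, Function.update y i t ∈ S → y ∈ S) {q : ℝ} (hq : 0 ≤ q)
    (h : ∀ y, (μ i).real {t | Function.update y i t ∈ B} ≤ q) :
    (Measure.pi μ).real B ≤ q * (Measure.pi μ).real S := by
  classical
  have key : ∀ x y : κ → ℝ, ({i} : Set κ).piecewise x y = Function.update y i (x i) := by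
    intro x y
    ext j
    by_cases hj : j = i
    · subst hj; simp [Set.piecewise]
    · simp [Set.piecewise, hj]
  refine pi_real_le_of_slices μ {i} hB hS hBS (fun x y hxy => ?_) hq fun y => ?_
  · rw [key] at hxy; exact hinv _ _ hxy
  · refine le_trans (le_of_eq ?_) (h y)
    have hm : MeasurableSet {t | Function.update y i t ∈ B} := (measurable_update y) hB
    rw [← (measurePreserving_eval μ i).measureReal_preimage hm.nullMeasurableSet]
    congr 1
    ext x
    simp [key]

/-! ### Anticoncentration of polynomials in one Gaussian variable -/

/-- Greedy choice: the `h`-balls around at most `D` chosen points have total length at most `2hD`,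
so they cannot cover `Q`. -/
theorem exists_separated_points {Q : Set ℝ} {h : ℝ} (hh : 0 < h) (D : ℕ)
    (hQ : ENNReal.ofReal (2 * h * D) < volume Q) :
    ∃ v : Fin (D + 1) → ℝ, (∀ i, v i ∈ Q) ∧ ∀ i j, i ≠ j → h ≤ |v i - v j| := by
  have key : ∀ l : ℕ, l ≤ D + 1 → ∃ v : Fin l → ℝ, (∀ i, v i ∈ Q) ∧
      ∀ i j, i ≠ j → h ≤ |v i - v j| := by
    intro l
    induction l with
    | zero => exact fun _ => ⟨Fin.elim0, fun i => i.elim0, fun i => i.elim0⟩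
    | succ l ih =>
      intro hl
      obtain ⟨v, hv, hsep⟩ := ih (by omega)
      have : ∃ x ∈ Q, ∀ i, h ≤ |x - v i| := by
        by_contra! hcon
        have hsub : Q ⊆ ⋃ i : Fin l, Metric.ball (v i) h := by
          intro x hx
          obtain ⟨i, hi⟩ := hcon x hx
          exact Set.mem_iUnion.2 ⟨i, by rwa [Metric.mem_ball, Real.dist_eq]⟩
        have h1 : volume Q ≤ ENNReal.ofReal (2 * h * l) := by
          refine (measure_mono hsub).trans ((measure_iUnion_fintype_le _ _).trans ?_)
          simp only [Real.volume_ball, Finset.sum_const, Finset.card_univ, Fintype.card_fin,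
            nsmul_eq_mul]
          rw [mul_comm (2 * h), ENNReal.ofReal_mul (p := (l : ℝ)) (by positivity),
            ENNReal.ofReal_natCast]
        have h2 : ENNReal.ofReal (2 * h * l) ≤ ENNReal.ofReal (2 * h * D) := by
          apply ENNReal.ofReal_le_ofReal
          have : (l : ℝ) ≤ D := by exact_mod_cast (by omega : l ≤ D)
          gcongr
        exact absurd hQ (not_lt.2 (h1.trans h2))
      obtain ⟨x, hx, hxs⟩ := this
      refine ⟨Fin.cons x v, fun i => ?_, fun i j hij => ?_⟩
      · refine Fin.cases ?_ (fun i => ?_) i <;> simp [hx, hv]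
      · revert hij
        refine Fin.cases ?_ (fun i => ?_) i <;> refine Fin.cases ?_ (fun j => ?_) j
        · simp
        · intro _; simpa using hxs j
        · intro _; simpa [abs_sub_comm] using hxs i
        · intro hij; simpa using hsep i j (fun h => hij (by rw [h]))
  exact key (D + 1) le_rfl

open Polynomial in
theorem abs_eval_derivative_basis_le {D : ℕ} (v : Fin (D + 1) → ℝ) {h r x : ℝ} (hh : 0 < h)
    (hr : 1 ≤ r) (hv : ∀ i, |v i| ≤ r) (hsep : ∀ i j, i ≠ j → h ≤ |v i - v j|) (hx : |x| ≤ r)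
    (i : Fin (D + 1)) :
    |(derivative (Lagrange.basis Finset.univ v i)).eval x| ≤ D * (2 * r / h) ^ D := by
  have hinv : ∀ j, i ≠ j → |(v i - v j)⁻¹| ≤ h⁻¹ := fun j hj => by
    rw [abs_inv]; exact inv_anti₀ hh (hsep i j hj)
  have h1 : ∀ j, i ≠ j → |(Lagrange.basisDivisor (v i) (v j)).eval x| ≤ 2 * r / h := by
    intro j hj
    rw [Lagrange.basisDivisor]
    simp only [eval_mul, eval_C, eval_sub, eval_X, abs_mul]
    have : |x - v j| ≤ 2 * r := (abs_sub _ _).trans (by linarith [hv j])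
    calc _ ≤ h⁻¹ * (2 * r) := mul_le_mul (hinv j hj) this (abs_nonneg _) (by positivity)
      _ = _ := by ring
  have h2 : ∀ j, i ≠ j →
      |(derivative (Lagrange.basisDivisor (v i) (v j))).eval x| ≤ 2 * r / h := by
    intro j hj
    rw [Lagrange.basisDivisor]
    simp only [derivative_mul, derivative_C, derivative_sub, derivative_X, zero_mul, zero_add,
      sub_zero, mul_one, eval_C]
    refine (hinv j hj).trans ?_
    rw [div_eq_mul_inv]
    exact le_mul_of_one_le_left (by positivity) (by linarith)
  have hcard : (Finset.univ.erase i).card = D := by simp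
  rw [Lagrange.basis, derivative_prod_finset, eval_finsetSum]
  refine (Finset.abs_sum_le_sum_abs _ _).trans ?_
  calc _ ≤ ∑ j ∈ Finset.univ.erase i, (2 * r / h) ^ D := by
        refine Finset.sum_le_sum fun j hj => ?_
        have hj' : i ≠ j := (Finset.ne_of_mem_erase hj).symm
        rw [eval_mul, abs_mul, eval_prod, Finset.abs_prod]
        have hle : ∏ l ∈ (Finset.univ.erase i).erase j,
            |(Lagrange.basisDivisor (v i) (v l)).eval x| ≤ (2 * r / h) ^ (D - 1) := by
          refine (Finset.prod_le_prod (fun _ _ => abs_nonneg _) fun l hl =>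
            h1 l (Finset.ne_of_mem_erase (Finset.mem_of_mem_erase hl)).symm).trans ?_
          rw [Finset.prod_const, Finset.card_erase_of_mem hj, hcard]
        have hD : D = D - 1 + 1 := by
          have : 0 < (Finset.univ.erase i).card := Finset.card_pos.2 ⟨j, hj⟩
          omega
        calc _ ≤ (2 * r / h) ^ (D - 1) * (2 * r / h) :=
              mul_le_mul hle (h2 j hj') (abs_nonneg _) (by positivity)
          _ = (2 * r / h) ^ D := by rw [← pow_succ, ← hD]
    _ = D * (2 * r / h) ^ D := by rw [Finset.sum_const, hcard, nsmul_eq_mul]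

open Polynomial in
-- A Remez-type bound: `P` equals its Lagrange interpolant at `D + 1` separated nodes, and each
-- basis polynomial has controlled derivative.
theorem abs_eval_derivative_le {D : ℕ} (P : ℝ[X]) (hP : P.natDegree ≤ D)
    (v : Fin (D + 1) → ℝ) {h r x t : ℝ} (hh : 0 < h)
    (hr : 1 ≤ r) (hv : ∀ i, |v i| ≤ r) (hsep : ∀ i j, i ≠ j → h ≤ |v i - v j|) (hx : |x| ≤ r)
    (ht : ∀ i, |P.eval (v i)| ≤ t) :
    |(derivative P).eval x| ≤ t * ((D + 1) * (D * (2 * r / h) ^ D)) := by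
  have hinj : Set.InjOn v (Finset.univ : Finset (Fin (D + 1))) := by
    intro i _ j _ hij
    by_contra hne
    have := hsep i j hne
    rw [hij, sub_self, abs_zero] at this
    linarith
  have hdeg : P.degree < (Finset.univ : Finset (Fin (D + 1))).card := by
    rw [Finset.card_univ, Fintype.card_fin]
    refine lt_of_le_of_lt degree_le_natDegree ?_
    exact_mod_cast Nat.lt_succ_of_le hP
  have ht0 : 0 ≤ t := (abs_nonneg _).trans (ht 0)
  rw [Lagrange.eq_interpolate hinj hdeg, Lagrange.interpolate_apply, derivative_sum,
    eval_finsetSum]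
  refine (Finset.abs_sum_le_sum_abs _ _).trans ?_
  calc _ ≤ ∑ i : Fin (D + 1), t * (D * (2 * r / h) ^ D) := by
        refine Finset.sum_le_sum fun i _ => ?_
        rw [derivative_C_mul, eval_C_mul, abs_mul]
        exact mul_le_mul (ht i) (abs_eval_derivative_basis_le v hh hr hv hsep hx i)
          (abs_nonneg _) ht0
    _ = _ := by
      rw [Finset.sum_const, Finset.card_univ, Fintype.card_fin, nsmul_eq_mul]
      push_cast; ring

theorem gaussianReal_le_volume (Q : Set ℝ) : gaussianReal 0 1 Q ≤ volume Q := by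
  rw [gaussianReal_apply 0 one_ne_zero, ← setLIntegral_one]
  refine lintegral_mono fun x => ?_
  rw [gaussianPDF, ← ENNReal.ofReal_one]
  refine ENNReal.ofReal_le_ofReal ?_
  rw [gaussianPDFReal]
  refine mul_le_one₀ (inv_le_one_of_one_le₀ ?_) (Real.exp_nonneg _) ?_
  · rw [Real.one_le_sqrt]
    have := Real.pi_gt_three
    simp only [NNReal.coe_one]; linarith
  · rw [Real.exp_le_one_iff]
    simp only [NNReal.coe_one, neg_div, neg_nonpos]
    positivity

theorem gaussianReal_real_abs_gt_exp {r : ℝ} (hr : 0 ≤ r) :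
    (gaussianReal 0 1).real {s | r < |s|} ≤ 2 * Real.exp (-(r ^ 2 / 2)) := by
  have h1 : (gaussianReal 0 1).real {s | r ≤ s} ≤ Real.exp (-(r ^ 2 / 2)) := by
    have := measure_ge_le_exp_mul_mgf (μ := gaussianReal 0 1) (X := id) r hr
      (integrable_exp_mul_gaussianReal r)
    rw [mgf_id_gaussianReal, ← Real.exp_add] at this
    refine this.trans (Real.exp_le_exp.2 (le_of_eq ?_))
    simp only [NNReal.coe_one]; ring
  have h2 : (gaussianReal 0 1).real {s | s ≤ -r} ≤ Real.exp (-(r ^ 2 / 2)) := by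
    have := measure_le_le_exp_mul_mgf (μ := gaussianReal 0 1) (X := id) (t := -r) (-r)
      (by linarith) (integrable_exp_mul_gaussianReal (-r))
    rw [mgf_id_gaussianReal, ← Real.exp_add] at this
    refine this.trans (Real.exp_le_exp.2 (le_of_eq ?_))
    simp only [NNReal.coe_one]; ring
  have hsub : {s : ℝ | r < |s|} ⊆ {s | r ≤ s} ∪ {s | s ≤ -r} := by
    intro s hs
    rcases lt_abs.1 (show r < |s| from hs) with h | h
    · exact Or.inl h.le
    · exact Or.inr (show s ≤ -r by linarith)
  refine (measureReal_mono hsub).trans ((measureReal_union_le _ _).trans ?_)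
  linarith

theorem gaussianReal_real_abs_gt {r : ℝ} (hr : 0 < r) :
    (gaussianReal 0 1).real {s | r < |s|} ≤ 4 / r ^ 2 := by
  refine (gaussianReal_real_abs_gt_exp hr.le).trans ?_
  have h1 : r ^ 2 / 2 ≤ Real.exp (r ^ 2 / 2) := by
    linarith [Real.add_one_le_exp (r ^ 2 / 2)]
  rw [Real.exp_neg]
  calc 2 * (Real.exp (r ^ 2 / 2))⁻¹ ≤ 2 * (r ^ 2 / 2)⁻¹ := by
        have := inv_anti₀ (by positivity) h1
        linarith
    _ = 4 / r ^ 2 := by field_simp; norm_num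

open Polynomial in
/-- Anticoncentration of a vector-valued polynomial whose derivative is large on `Q`. -/
theorem gaussianReal_real_le_of_polynomial {D : ℕ} (hD : 1 ≤ D) {r t e : ℝ} (hr : 1 ≤ r)
    {Q : Set ℝ}
    (hQ : ∀ s ∈ Q, ∃ P : ℝ[X], P.natDegree ≤ D ∧ (∀ u ∈ Q, |P.eval u| ≤ t) ∧
      e < |(derivative P).eval s|)
    (hte : t * ((D + 1) * (D * (2 * r * r) ^ D)) ≤ e) :
    (gaussianReal 0 1).real Q ≤ (2 * D + 4) / r := by
  have hr0 : 0 < r := by linarith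
  set Q' := Q ∩ {s | |s| ≤ r} with hQ'
  -- Otherwise `Q'` contains `D + 1` points with gaps `1 / r`. The polynomial attached to one of
  -- them is at most `t` at all of them, so interpolation contradicts its large derivative there.
  -- Hence the polynomial may vary with `s`.
  have hvol : volume Q' ≤ ENNReal.ofReal (2 * (1 / r) * D) := by
    by_contra hlt
    rw [not_le] at hlt
    obtain ⟨v, hv, hsep⟩ := exists_separated_points (by positivity) D hlt
    obtain ⟨P, hPd, hPt, hPe⟩ := hQ (v 0) (hv 0).1
    have := abs_eval_derivative_le P hPd v (by positivity : 0 < 1 / r) hr (fun i => (hv i).2) hsep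
      (hv 0).2 (fun i => hPt _ (hv i).1)
    rw [div_div_eq_mul_div, div_one] at this
    linarith
  have h1 : (gaussianReal 0 1).real Q' ≤ 2 * (1 / r) * D :=
    ENNReal.toReal_le_of_le_ofReal (by positivity) ((gaussianReal_le_volume _).trans hvol)
  have hsub : Q ⊆ Q' ∪ {s | r < |s|} := by
    intro s hs
    rcases le_or_gt |s| r with h | h
    · exact Or.inl ⟨hs, h⟩
    · exact Or.inr h
  have h2 := (measureReal_mono (μ := gaussianReal 0 1) hsub).trans (measureReal_union_le _ _)
  have h3 : 4 / r ^ 2 ≤ 4 / r := by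
    gcongr
    nlinarith
  have h4 := gaussianReal_real_abs_gt hr0
  calc _ ≤ 2 * (1 / r) * D + 4 / r := by linarith
    _ = _ := by ring

/-! ### Slices of symmetric tensors -/

theorem cons_comp_decomposeFin {α : Type*} {d : ℕ} (a : α) (j : Fin d → α)
    (π : Equiv.Perm (Fin d)) :
    (Fin.cons a j : Fin (d + 1) → α) ∘ (Equiv.Perm.decomposeFin.symm (0, π)) =
      Fin.cons a (j ∘ π) := by
  funext k
  refine Fin.cases ?_ (fun k => ?_) k
  · simp
  · simp

theorem apply_insertNth_of_symmetric {α β : Type*} {d : ℕ} {T : (Fin (d + 1) → α) → β}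
    (hT : ∀ (π : Equiv.Perm (Fin (d + 1))) (j), T (j ∘ π) = T j) (k : Fin (d + 1)) (a : α)
    (j : Fin d → α) :
    T (k.insertNth a j) = T (Fin.cons a j) := by
  rw [← hT k.cycleRange.symm (k.insertNth a j)]
  congr 1
  funext l
  simp [← Fin.insertNth_zero']

/-- The slice `T(a, ·, …, ·)` of a symmetric tensor. -/
def symSlice (n d : ℕ) (a : Fin n) : SymTensor n (d + 1) →ₗ[ℝ] SymTensor n d where
  toFun T := ⟨WithLp.toLp 2 fun j => T.1 (Fin.cons a j), fun π j => by
    change T.1 (Fin.cons a (j ∘ π)) = T.1 (Fin.cons a j)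
    rw [← cons_comp_decomposeFin]
    exact T.2 _ _⟩
  map_add' _ _ := rfl
  map_smul' _ _ := rfl

theorem symSlice_apply {n d : ℕ} (a : Fin n) (T : SymTensor n (d + 1)) (j : Fin d → Fin n) :
    (symSlice n d a T).1 j = T.1 (Fin.cons a j) := rfl

theorem sum_symSlice_norm_sq {n d : ℕ} (T : SymTensor n (d + 1)) :
    ∑ a, ‖symSlice n d a T‖ ^ 2 = ‖T‖ ^ 2 := by
  simp only [Submodule.coe_norm, EuclideanSpace.norm_sq_eq, symSlice_apply]
  rw [← (Fin.consEquiv fun _ => Fin n).sum_comp, Fintype.sum_prod_type]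
  rfl

theorem symSlice_norm_le {n d : ℕ} (a : Fin n) (T : SymTensor n (d + 1)) :
    ‖symSlice n d a T‖ ≤ ‖T‖ := by
  refine le_of_sq_le_sq ?_ (norm_nonneg _)
  rw [← sum_symSlice_norm_sq T]
  exact Finset.single_le_sum (f := fun a => ‖symSlice n d a T‖ ^ 2)
    (fun _ _ => sq_nonneg _) (Finset.mem_univ a)

/-- By symmetry the index `a` can be moved from mode `k` to the first mode. -/
theorem SymTensor.apply_eq_zero_of_symSlice {n d : ℕ} {a : Fin n} {T : SymTensor n (d + 1)}
    (hT : symSlice n d a T = 0) {j : Fin (d + 1) → Fin n} {k : Fin (d + 1)} (hk : j k = a) :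
    T.1 j = 0 := by
  have h := apply_insertNth_of_symmetric (T := T.1.ofLp) T.2 k (j k) (k.removeNth j)
  rw [Fin.insertNth_self_removeNth] at h
  rw [h, hk, ← symSlice_apply, hT]
  rfl

/-- A linear map that is large on average is bounded below on a large subspace. -/
theorem exists_subspace_norm_le {V H : Type*} [NormedAddCommGroup V] [InnerProductSpace ℝ V]
    [FiniteDimensional ℝ V] [NormedAddCommGroup H] [InnerProductSpace ℝ H]
    [FiniteDimensional ℝ H] (A : V →ₗ[ℝ] H) (hA : ∀ x, ‖A x‖ ≤ ‖x‖) {ι : Type*} [Fintype ι]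
    (b : OrthonormalBasis ι ℝ V) {θ : ℝ} (hθ : 0 ≤ θ)
    (hb : 2 * θ * Module.finrank ℝ V ≤ ∑ i, ‖A (b i)‖ ^ 2) :
    ∃ E : Submodule ℝ V, θ * Module.finrank ℝ V ≤ Module.finrank ℝ E ∧
      ∀ x ∈ E, θ * ‖x‖ ^ 2 ≤ ‖A x‖ ^ 2 := by
  classical
  have hS := A.isSymmetric_adjoint_comp_self
  set v := hS.eigenvectorBasis rfl with hv
  set l := hS.eigenvalues rfl with hl
  have hAA : ∀ x y, inner ℝ x ((A.adjoint ∘ₗ A) y) = inner ℝ (A x) (A y) := fun x y => by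
    rw [LinearMap.comp_apply, LinearMap.adjoint_inner_right]
  have hAx : ∀ x, ‖A x‖ ^ 2 = ∑ i, l i * inner ℝ (v i) x ^ 2 := by
    intro x
    rw [← real_inner_self_eq_norm_sq, ← hAA, ← v.sum_inner_mul_inner]
    refine Finset.sum_congr rfl fun i _ => ?_
    have : inner ℝ (v i) ((A.adjoint ∘ₗ A) x) = l i * inner ℝ (v i) x := by
      rw [← hS, hS.apply_eigenvectorBasis]
      simp [inner_smul_left, hv, hl]
    rw [this, real_inner_comm]
    ring
  have hlv : ∀ i, l i = ‖A (v i)‖ ^ 2 := by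
    intro i
    rw [hAx]
    simp [orthonormal_iff_ite.1 v.orthonormal]
  have hsum : ∑ i, l i = ∑ i, ‖A (b i)‖ ^ 2 := by
    have h2 := (A.adjoint ∘ₗ A).trace_eq_sum_inner b
    have h3 := (A.adjoint ∘ₗ A).trace_eq_sum_inner v
    rw [Finset.sum_congr rfl fun i _ => hlv i]
    simp only [hAA, real_inner_self_eq_norm_sq] at h2 h3
    rw [← h2, ← h3]
  have hl1 : ∀ i, l i ≤ 1 := by
    intro i
    rw [hlv]
    have := hA (v i)
    rw [v.orthonormal.1 i] at this
    exact pow_le_one₀ (norm_nonneg _) this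
  set g : Finset (Fin (Module.finrank ℝ V)) := {i | θ ≤ l i} with hg
  refine ⟨Submodule.span ℝ (Set.range fun i : g => v i), ?_, ?_⟩
  · have hli : LinearIndependent ℝ (fun i : g => v i) :=
      v.orthonormal.linearIndependent.comp _ Subtype.val_injective
    rw [finrank_span_eq_card hli, Fintype.card_coe]
    -- Eigenvalues of `A* A` are at most 1, and below `θ` off `g`. A trace of at least `2θ dim V`
    -- thus forces `g` to have at least `θ dim V` elements.
    have h1 : ∑ i, l i ≤ ∑ i, ((if i ∈ g then (1 : ℝ) else 0) + θ) := by
      refine Finset.sum_le_sum fun i _ => ?_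
      by_cases hi : i ∈ g
      · simp only [hi, if_true]; linarith [hl1 i]
      · simp only [hi, if_false]
        have : l i < θ := by simpa [hg] using hi
        linarith
    rw [Finset.sum_add_distrib] at h1
    simp only [Finset.sum_ite_mem, Finset.univ_inter, Finset.sum_const, nsmul_eq_mul, mul_one,
      Finset.card_univ, Fintype.card_fin] at h1
    linarith
  · intro x hx
    have hz : ∀ i, i ∉ g → inner ℝ (v i) x = 0 := by
      intro i hi
      induction hx using Submodule.span_induction with
      | mem y hy =>
        obtain ⟨k, rfl⟩ := hy
        simp only [orthonormal_iff_ite.1 v.orthonormal]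
        rw [if_neg]
        rintro rfl
        exact hi k.2
      | zero => simp
      | add y z _ _ hy hz => rw [inner_add_right, hy, hz, add_zero]
      | smul c y _ hy => rw [inner_smul_right, hy, mul_zero]
    rw [hAx, ← real_inner_self_eq_norm_sq, ← v.sum_inner_mul_inner, Finset.mul_sum]
    refine Finset.sum_le_sum fun i _ => ?_
    rw [real_inner_comm, ← sq]
    by_cases hi : i ∈ g
    · have : θ ≤ l i := by simpa [hg] using hi
      gcongr
    · simp [hz i hi]

/-- The slices split the squared norm, so their Hilbert–Schmidt masses on `W` add up to `dim W`. One
of the `n` slices has at least the average mass, and `exists_subspace_norm_le` applies with `θ = 1 /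
(2n)`. -/
theorem exists_large_slice {n d : ℕ} (hn : 0 < n) (W : Submodule ℝ (SymTensor n (d + 1))) :
    ∃ (a : Fin n) (E : Submodule ℝ (SymTensor n (d + 1))), E ≤ W ∧
      (Module.finrank ℝ W : ℝ) ≤ 2 * n * Module.finrank ℝ E ∧
      ∀ T ∈ E, ‖T‖ ^ 2 ≤ 2 * n * ‖symSlice n d a T‖ ^ 2 := by
  have hn' : (0 : ℝ) < n := by exact_mod_cast hn
  set b := stdOrthonormalBasis ℝ W
  have h1 : ∑ a, ∑ i, ‖symSlice n d a (b i)‖ ^ 2 = Module.finrank ℝ W := by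
    rw [Finset.sum_comm]
    simp only [sum_symSlice_norm_sq]
    have : ∀ i, ‖(b i : SymTensor n (d + 1))‖ = 1 := fun i => b.orthonormal.1 i
    simp [this]
  obtain ⟨a, -, ha⟩ : ∃ a ∈ (Finset.univ : Finset (Fin n)),
      (Module.finrank ℝ W : ℝ) / n ≤ ∑ i, ‖symSlice n d a (b i)‖ ^ 2 := by
    refine Finset.exists_le_of_sum_le ⟨⟨0, hn⟩, Finset.mem_univ _⟩ ?_
    rw [h1, Finset.sum_const, Finset.card_univ, Fintype.card_fin, nsmul_eq_mul]
    field_simp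
    exact le_rfl
  obtain ⟨E, hE, hE'⟩ := exists_subspace_norm_le (symSlice n d a ∘ₗ W.subtype)
    (fun x => symSlice_norm_le a _) b (θ := 1 / (2 * n)) (by positivity) (by
      refine le_trans (le_of_eq ?_) ha
      field_simp)
  refine ⟨a, E.map W.subtype, Submodule.map_subtype_le _ _, ?_, ?_⟩
  · rw [(Submodule.equivMapOfInjective _ W.injective_subtype E).symm.finrank_eq]
    rw [div_mul_eq_mul_div, one_mul, div_le_iff₀ (by positivity)] at hE
    linarith
  · rintro _ ⟨T, hT, rfl⟩
    have := hE' T hT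
    rw [div_mul_eq_mul_div, one_mul, div_le_iff₀ (by positivity)] at this
    rw [mul_comm (2 * (n : ℝ))]
    exact this

/-! ### The pairing with a tensor power as a polynomial in one entry -/

/-- `⟨T, Z^{⊗d} f⟩`, where `f` is an array of coefficients. -/
def tensorEval {n d : ℕ} {ι : Type*} [Fintype ι] (T : TensorSpace n d) (f : (Fin d → ι) → ℝ)
    (Z : Fin n × ι → ℝ) : ℝ :=
  ∑ j, ∑ i, T j * f i * ∏ k, Z (j k, i k)

theorem continuous_tensorEval {n d : ℕ} {ι : Type*} [Fintype ι] (T : TensorSpace n d)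
    (f : (Fin d → ι) → ℝ) : Continuous (tensorEval T f) := by
  unfold tensorEval
  fun_prop

theorem tensorEval_update_of_symSlice {n d : ℕ} {ι : Type*} [Fintype ι] [DecidableEq ι]
    {a : Fin n} {T : SymTensor n (d + 1)} (hT : symSlice n d a T = 0) (f : (Fin (d + 1) → ι) → ℝ)
    (Z : Fin n × ι → ℝ) (c : ι) (s : ℝ) :
    tensorEval T.1 f (Function.update Z (a, c) s) = tensorEval T.1 f Z := by
  refine Finset.sum_congr rfl fun j _ => Finset.sum_congr rfl fun i _ => ?_
  by_cases h : ∃ k, j k = a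
  · obtain ⟨k, hk⟩ := h
    rw [SymTensor.apply_eq_zero_of_symSlice hT hk]
    ring
  · congr 1
    refine Finset.prod_congr rfl fun k _ => ?_
    rw [Function.update_of_ne]
    intro he
    exact h ⟨k, congrArg Prod.fst he⟩

theorem sum_eq_sum_insertNth {α M : Type*} [Fintype α] [AddCommMonoid M] {d : ℕ}
    (F : (Fin (d + 1) → α) → M) (k : Fin (d + 1)) :
    ∑ j, F j = ∑ a, ∑ j, F (k.insertNth a j) := by
  rw [← (Fin.insertNthEquiv (fun _ => α) k).sum_comp, Fintype.sum_prod_type]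
  rfl

theorem prod_univ_erase_eq_prod_succAbove {M : Type*} [CommMonoid M] {d : ℕ}
    (g : Fin (d + 1) → M) (k : Fin (d + 1)) :
    ∏ l ∈ Finset.univ.erase k, g l = ∏ l, g (k.succAbove l) := by
  rw [Fin.univ_succAbove d k, Finset.erase_cons, Finset.prod_map]
  rfl

open Polynomial in
-- The product rule gives one term for each of the `d + 1` modes; the symmetry of both `T` and `f`
-- makes these terms equal.
theorem exists_polynomial_tensorEval {n d : ℕ} {ι : Type*} [Fintype ι] [DecidableEq ι]
    (T : SymTensor n (d + 1)) {f : (Fin (d + 1) → ι) → ℝ}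
    (hf : ∀ (π : Equiv.Perm (Fin (d + 1))) (i), f (i ∘ π) = f i)
    (Z : Fin n × ι → ℝ) (a : Fin n) (c : ι) :
    ∃ P : ℝ[X], P.natDegree ≤ d + 1 ∧
      (∀ s, P.eval s = tensorEval T.1 f (Function.update Z (a, c) s)) ∧
      ∀ s, (derivative P).eval s = (d + 1) *
        tensorEval (symSlice n d a T).1 (fun i => f (Fin.cons c i))
          (Function.update Z (a, c) s) := by
  set g : Fin n × ι → ℝ[X] := fun p => if p = (a, c) then X else C (Z p) with hg
  have hge : ∀ s p, (g p).eval s = Function.update Z (a, c) s p := by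
    intro s p
    by_cases hp : p = (a, c)
    · simp [hg, hp]
    · simp [hg, hp]
  have hgd : ∀ s p, (derivative (g p)).eval s = if p = (a, c) then 1 else 0 := by
    intro s p
    by_cases hp : p = (a, c)
    · simp [hg, hp]
    · simp [hg, hp]
  refine ⟨∑ j, ∑ i, C (T.1 j * f i) * ∏ k, g (j k, i k), ?_, ?_, ?_⟩
  · refine natDegree_sum_le_of_forall_le _ _ fun j _ =>
      natDegree_sum_le_of_forall_le _ _ fun i _ => (natDegree_C_mul_le _ _).trans ?_
    refine (natDegree_prod_le _ _).trans ?_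
    calc _ ≤ ∑ k : Fin (d + 1), 1 := Finset.sum_le_sum fun k _ => by
          simp only [hg]
          split_ifs <;> simp
      _ = d + 1 := by simp
  · intro s
    simp only [eval_finsetSum, eval_mul, eval_C, eval_prod, hge, tensorEval]
  · intro s
    simp only [derivative_sum, derivative_C_mul, derivative_prod_finset, eval_finsetSum,
      eval_mul, eval_C, eval_prod, hge, hgd, Finset.mul_sum]
    have hk : ∀ k : Fin (d + 1), ∑ j, ∑ i, T.1 j * f i *
        ((∏ l ∈ Finset.univ.erase k, Function.update Z (a, c) s (j l, i l)) *
          if (j k, i k) = (a, c) then 1 else 0) =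
        tensorEval (symSlice n d a T).1 (fun i => f (Fin.cons c i))
          (Function.update Z (a, c) s) := by
      intro k
      rw [sum_eq_sum_insertNth _ k, Finset.sum_eq_single a, tensorEval]
      · refine Finset.sum_congr rfl fun y _ => ?_
        rw [sum_eq_sum_insertNth _ k, Finset.sum_eq_single c]
        · refine Finset.sum_congr rfl fun i _ => ?_
          rw [apply_insertNth_of_symmetric (T := T.1.ofLp) T.2,
            apply_insertNth_of_symmetric hf, prod_univ_erase_eq_prod_succAbove]
          simp [symSlice_apply]
        · intro x _ hx
          simp [hx]
        · simp
      · intro x _ hx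
        simp [hx]
      · simp
    have hc : ∑ j, ∑ i, ∑ k, T.1 j * f i *
        ((∏ l ∈ Finset.univ.erase k, Function.update Z (a, c) s (j l, i l)) *
          if (j k, i k) = (a, c) then 1 else 0) = ∑ k, ∑ j, ∑ i, T.1 j * f i *
        ((∏ l ∈ Finset.univ.erase k, Function.update Z (a, c) s (j l, i l)) *
          if (j k, i k) = (a, c) then 1 else 0) := by
      rw [Finset.sum_comm (s := Finset.univ (α := Fin (d + 1)))]
      exact Finset.sum_congr rfl fun j _ => Finset.sum_comm
    rw [hc, Finset.sum_congr rfl fun k _ => hk k]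
    simp

/-! ### Anticoncentration of tensor powers in large subspaces -/

/-- The law of a standard Gaussian array. -/
noncomputable def stdGaussianArray (κ : Type*) [Fintype κ] : Measure (κ → ℝ) :=
  Measure.pi fun _ => gaussianReal 0 1

instance (κ : Type*) [Fintype κ] : IsProbabilityMeasure (stdGaussianArray κ) := by
  unfold stdGaussianArray; infer_instance

/-- The arrays `Z` for which `Z^{⊗d} f` has projection to `W` of norm at most `t`. -/
def smallProjSet {n d : ℕ} {ι : Type*} [Fintype ι] (W : Submodule ℝ (SymTensor n d))
    (f : (Fin d → ι) → ℝ) (t : ℝ) : Set (Fin n × ι → ℝ) :=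
  {Z | ∀ T ∈ W, |tensorEval T.1 f Z| ≤ t * ‖T‖}

theorem measurableSet_smallProjSet {n d : ℕ} {ι : Type*} [Fintype ι]
    (W : Submodule ℝ (SymTensor n d)) (f : (Fin d → ι) → ℝ) (t : ℝ) :
    MeasurableSet (smallProjSet W f t) := by
  have : smallProjSet W f t = ⋂ T ∈ W, {Z | |tensorEval T.1 f Z| ≤ t * ‖T‖} := by
    ext Z; simp [smallProjSet]
  rw [this]
  exact (isClosed_biInter fun T _ => isClosed_le (continuous_tensorEval T.1 f).abs
    continuous_const).measurableSet

theorem finrank_symTensor_le (n d : ℕ) : Module.finrank ℝ (SymTensor n d) ≤ n ^ d := by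
  refine (Submodule.finrank_le _).trans ?_
  simp

theorem finrank_le_finrank_inf_ker {V H : Type*} [AddCommGroup V] [Module ℝ V]
    [FiniteDimensional ℝ V] [AddCommGroup H] [Module ℝ H] [FiniteDimensional ℝ H]
    (A : V →ₗ[ℝ] H) (W : Submodule ℝ V) :
    Module.finrank ℝ W ≤ Module.finrank ℝ (W ⊓ LinearMap.ker A : Submodule ℝ V) +
      Module.finrank ℝ H := by
  have h := (A ∘ₗ W.subtype).finrank_range_add_finrank_ker
  have h1 := Submodule.finrank_le (LinearMap.range (A ∘ₗ W.subtype))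
  have h2 : Module.finrank ℝ (LinearMap.ker (A ∘ₗ W.subtype)) =
      Module.finrank ℝ (W ⊓ LinearMap.ker A : Submodule ℝ V) := by
    rw [(Submodule.equivMapOfInjective _ W.injective_subtype _).finrank_eq, LinearMap.ker_comp,
      Submodule.map_comap_subtype]
  omega

/-- Take a slice `a` bounded below on `E ≤ W`, and let `F` be the image of `E`. The event that the
lower-order power is small on `F` costs `p`. Off it, some `T ∈ E` has large derivative in the entry
`(a, c)`, so this entry alone gains `(2D + 4) / r`. The event for `W'`, the tensors of `W` with
vanishing slice `a`, does not depend on that entry, so its probability survives as a factor. -/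
theorem smallProjSet_step {n d D : ℕ} (hd : d + 1 ≤ D) (hn : 0 < n) {ι : Type*} [Fintype ι]
    (W : Submodule ℝ (SymTensor n (d + 1))) {f : (Fin (d + 1) → ι) → ℝ}
    (hf : ∀ (π : Equiv.Perm (Fin (d + 1))) (i), f (i ∘ π) = f i) (c : ι)
    {r t e p : ℝ} (hr : 1 ≤ r) (he : 0 ≤ e)
    (hte : t * ((D + 1) * (D * (2 * r * r) ^ D)) ≤ e / (2 * n))
    (hp : ∀ F : Submodule ℝ (SymTensor n d),
      (Module.finrank ℝ W : ℝ) ≤ 2 * n * Module.finrank ℝ F →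
      (stdGaussianArray (Fin n × ι)).real (smallProjSet F (fun i => f (Fin.cons c i)) e) ≤ p) :
    ∃ W' ≤ W, Module.finrank ℝ W ≤ Module.finrank ℝ W' + n ^ d ∧
      (stdGaussianArray (Fin n × ι)).real (smallProjSet W f t) ≤
        p + (2 * D + 4) / r * (stdGaussianArray (Fin n × ι)).real (smallProjSet W' f t) := by
  classical
  have hn' : (1 : ℝ) ≤ n := by exact_mod_cast hn
  obtain ⟨a, E, hEW, hE, hEn⟩ := exists_large_slice hn W
  set F := E.map (symSlice n d a) with hF
  have hinj : Set.InjOn (symSlice n d a) E := by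
    intro x hx y hy hxy
    have h := hEn (x - y) (E.sub_mem hx hy)
    rw [map_sub, hxy, sub_self, norm_zero] at h
    have h0 : ‖x - y‖ ^ 2 ≤ 0 := by simpa using h
    have : ‖x - y‖ = 0 := by nlinarith [norm_nonneg (x - y)]
    exact sub_eq_zero.1 (norm_eq_zero.1 this)
  have hFE : Module.finrank ℝ F = Module.finrank ℝ E := by
    have h1 : F = LinearMap.range (symSlice n d a ∘ₗ E.subtype) := by
      rw [LinearMap.range_comp, Submodule.range_subtype]
    rw [h1]
    refine LinearMap.finrank_range_of_inj fun x y hxy => ?_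
    exact Subtype.ext (hinj x.2 y.2 hxy)
  refine ⟨W ⊓ LinearMap.ker (symSlice n d a), inf_le_left,
    (finrank_le_finrank_inf_ker _ W).trans (Nat.add_le_add_left (finrank_symTensor_le n d) _), ?_⟩
  set W' := W ⊓ LinearMap.ker (symSlice n d a)
  set G := smallProjSet F (fun i => f (Fin.cons c i)) e with hG
  have hWm := measurableSet_smallProjSet W f t
  have hGm : MeasurableSet G := measurableSet_smallProjSet F _ e
  have hsub : smallProjSet W f t ⊆ G ∪ (smallProjSet W f t \ G) := by
    intro Z hZ
    by_cases h : Z ∈ G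
    · exact Or.inl h
    · exact Or.inr ⟨hZ, h⟩
  refine (measureReal_mono hsub).trans ((measureReal_union_le _ _).trans (add_le_add
    (hp F (by rw [hFE]; exact hE)) ?_))
  refine pi_real_le_of_update (fun _ => gaussianReal 0 1) (a, c) (hWm.diff hGm)
    (measurableSet_smallProjSet W' f t) ?_ ?_ (by positivity) ?_
  · exact fun Z hZ T hT => hZ.1 T hT.1
  · intro Z s hZ T hT
    have h := hZ T hT
    rwa [tensorEval_update_of_symSlice (LinearMap.mem_ker.1 hT.2)] at h
  · intro Z
    refine gaussianReal_real_le_of_polynomial (le_trans (by omega) hd) hr (t := t)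
      (e := e / (2 * n)) (fun s hs => ?_) hte
    have hs2 : Function.update Z (a, c) s ∉ G := hs.2
    simp only [hG, smallProjSet, Set.mem_ofPred_eq, not_forall, not_le] at hs2
    -- This `T` depends on the value `s` of the entry, but being in `W` it gives a polynomial
    -- bounded by `t` on the whole event, after division by `‖T‖`.
    obtain ⟨S, ⟨T, hT, rfl⟩, hS⟩ := hs2
    obtain ⟨P, hPd, hPe, hPe'⟩ := exists_polynomial_tensorEval T hf Z a c
    have hT0 : 0 < ‖T‖ := by
      rw [norm_pos_iff]
      rintro rfl
      simp [tensorEval] at hS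
    have hTS : ‖T‖ ≤ 2 * n * ‖symSlice n d a T‖ := by
      refine le_of_sq_le_sq ((hEn T hT).trans ?_) (by positivity)
      rw [mul_pow]
      gcongr
      nlinarith
    refine ⟨Polynomial.C ‖T‖⁻¹ * P, ?_, ?_, ?_⟩
    · exact (Polynomial.natDegree_C_mul_le _ _).trans (hPd.trans hd)
    · intro u hu
      rw [Polynomial.eval_C_mul, hPe, abs_mul, abs_inv, abs_norm, inv_mul_le_iff₀ hT0, mul_comm]
      exact hu.1 T (hEW hT)
    · rw [Polynomial.derivative_C_mul, Polynomial.eval_C_mul, hPe', abs_mul, abs_inv, abs_norm,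
        lt_inv_mul_iff₀ hT0, abs_mul]
      have h1 : (1 : ℝ) ≤ |(d : ℝ) + 1| := by
        rw [abs_of_nonneg (by positivity)]
        linarith [(Nat.cast_nonneg d : (0 : ℝ) ≤ d)]
      calc ‖T‖ * (e / (2 * n)) ≤ 2 * n * ‖symSlice n d a T‖ * (e / (2 * n)) := by gcongr
        _ = e * ‖symSlice n d a T‖ := by field_simp
        _ < _ := hS
        _ ≤ _ := le_mul_of_one_le_left (abs_nonneg _) h1

/-- Anticoncentration of `Z^{⊗d} f` in a large subspace of the symmetric tensors. -/
theorem smallProjSet_real_le {n D k : ℕ} (hn : 0 < n) (hk : 0 < k) {ι : Type*} [Fintype ι]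
    {r η : ℝ} (hr : 1 ≤ r) (hη : 0 < η) (hDr : 2 * D + 4 ≤ r)
    (hηr : η * ((D + 1) * (D * (2 * r * r) ^ D)) ≤ 1 / (2 * n)) :
    ∀ d ≤ D, ∀ (W : Submodule ℝ (SymTensor n d)) (f : (Fin d → ι) → ℝ),
      3 ^ d * k * n ^ d ≤ n * Module.finrank ℝ W →
      (∀ (π : Equiv.Perm (Fin d)) (i), f (i ∘ π) = f i) → (∃ i, 1 ≤ |f i|) →
      (stdGaussianArray (Fin n × ι)).real (smallProjSet W f (η ^ d / 2)) ≤
        d * (k : ℝ) ^ d * ((2 * D + 4) / r) ^ k := by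
  have hr0 : 0 < r := by linarith
  set q := (2 * D + 4) / r with hq
  have hq0 : 0 ≤ q := by positivity
  have hq1 : q ≤ 1 := (div_le_one hr0).2 hDr
  have hk1 : (1 : ℝ) ≤ k := by exact_mod_cast hk
  intro d
  induction d with
  | zero =>
    intro _ W f hW _ ⟨i₀, hi₀⟩
    have hpos : 0 < Module.finrank ℝ W := by
      rcases Nat.eq_zero_or_pos (Module.finrank ℝ W) with h | h
      · rw [h] at hW
        simp at hW
        omega
      · exact h
    have : Nontrivial W := Module.finrank_pos_iff.1 hpos
    obtain ⟨T, hT⟩ := exists_ne (0 : W)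
    -- In order 0 the pairing is the scalar `T · f`, of modulus at least `‖T‖`; the factor `1/2` in
    -- the threshold makes the event empty.
    have hempty : smallProjSet W f (η ^ 0 / 2) = ∅ := by
      ext Z
      simp only [Set.mem_empty_iff_false, iff_false]
      intro hZ
      have h := hZ T T.2
      have hT' : (T : SymTensor n 0).1 ≠ 0 := fun h => hT (Subtype.ext (Subtype.ext h))
      have hnorm : ‖(T : SymTensor n 0)‖ = |(T : SymTensor n 0).1 default| := by
        rw [Submodule.coe_norm, EuclideanSpace.norm_eq]
        simp [Real.sqrt_sq_eq_abs]
      have hev : tensorEval (T : SymTensor n 0).1 f Z = (T : SymTensor n 0).1 default * f i₀ := by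
        simp only [tensorEval, Finset.univ_unique, Finset.sum_singleton]
        simp [Subsingleton.elim i₀ default]
      rw [hev, abs_mul, ← hnorm] at h
      have hp : 0 < ‖(T : SymTensor n 0)‖ := by
        rw [Submodule.coe_norm]; exact norm_pos_iff.2 hT'
      nlinarith
    rw [hempty]
    simp
  | succ d ih =>
    intro hd W f hW hf ⟨i₀, hi₀⟩
    set p : ℝ := d * (k : ℝ) ^ d * q ^ k with hp
    have hp0 : 0 ≤ p := by positivity
    -- Each of `l` steps uses up `n ^ d` dimensions, and the reserve `2 * 3 ^ d * k * n ^ d` keeps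
    -- the induction hypothesis applicable after the loss of the factor `2n`. For `l = k` the total
    -- is covered by `3 ^ (d + 1) * k * n ^ d`.
    have key : ∀ l : ℕ, ∀ W : Submodule ℝ (SymTensor n (d + 1)),
        (2 * 3 ^ d * k + l) * n ^ d ≤ Module.finrank ℝ W →
        (stdGaussianArray (Fin n × ι)).real (smallProjSet W f (η ^ (d + 1) / 2)) ≤
          l * p + q ^ l := by
      intro l
      induction l with
      | zero =>
        intro W _
        simp [measureReal_le_one]
      | succ l ihl =>
        intro W hW
        obtain ⟨W', -, hW', hb⟩ := smallProjSet_step hd hn W hf (i₀ 0) hr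
          (t := η ^ (d + 1) / 2) (e := η ^ d / 2) (p := p) (by positivity) (by
            calc _ = η ^ d / 2 * (η * ((D + 1) * (D * (2 * r * r) ^ D))) := by ring
              _ ≤ η ^ d / 2 * (1 / (2 * n)) := by gcongr
              _ = _ := by ring) (fun F hF => by
            refine ih (by omega) F _ ?_ ?_ ?_
            · have hF' : Module.finrank ℝ W ≤ 2 * n * Module.finrank ℝ F := by exact_mod_cast hF
              have : 2 * 3 ^ d * k * n ^ d ≤ 2 * n * Module.finrank ℝ F := by
                refine le_trans ?_ (hW.trans hF')
                exact Nat.mul_le_mul_right _ (Nat.le_add_right _ _)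
              nlinarith
            · intro π i
              rw [← cons_comp_decomposeFin, hf]
            · exact ⟨Fin.tail i₀, by simpa using hi₀⟩)
        have h1 := ihl W' (by
          have : (2 * 3 ^ d * k + (l + 1)) * n ^ d = (2 * 3 ^ d * k + l) * n ^ d + n ^ d := by ring
          omega)
        calc _ ≤ p + q * (l * p + q ^ l) := hb.trans (by gcongr)
          _ = p + q * (l * p) + q ^ (l + 1) := by ring
          _ ≤ p + 1 * (l * p) + q ^ (l + 1) := by gcongr
          _ = _ := by push_cast; ring
    refine (key k W ?_).trans ?_
    · have h1 : 3 ^ (d + 1) * k * n ^ (d + 1) = n * (3 ^ (d + 1) * k * n ^ d) := by ring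
      rw [h1] at hW
      refine le_trans ?_ (Nat.le_of_mul_le_mul_left hW hn)
      refine Nat.mul_le_mul_right _ ?_
      have : 1 * k ≤ 3 ^ d * k := Nat.mul_le_mul_right _ (Nat.one_le_pow _ _ (by norm_num))
      rw [pow_succ]
      linarith
    · have h2 : q ^ k ≤ (k : ℝ) ^ (d + 1) * q ^ k :=
        le_mul_of_one_le_left (by positivity) (one_le_pow₀ hk1)
      calc _ = d * (k : ℝ) ^ (d + 1) * q ^ k + q ^ k := by rw [hp]; ring
        _ ≤ d * (k : ℝ) ^ (d + 1) * q ^ k + (k : ℝ) ^ (d + 1) * q ^ k := by gcongr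
        _ = _ := by push_cast; ring

/-! ### Pairings with pure tensors, and contractions -/

/-- The pairing of a tensor with a pure tensor, as a multilinear map. -/
noncomputable def tensorDot {n d : ℕ} (T : TensorSpace n d) :
    MultilinearMap ℝ (fun _ : Fin d => Fin n → ℝ) ℝ :=
  ∑ j, T j • (MultilinearMap.mkPiAlgebra ℝ (Fin d) ℝ).compLinearMap
    (fun k => LinearMap.proj (j k))

theorem tensorDot_apply {n d : ℕ} (T : TensorSpace n d) (v : Fin d → Fin n → ℝ) :
    tensorDot T v = ∑ j, T j * ∏ k, v k (j k) := by
  simp [tensorDot]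

theorem inner_pureTensor {n d : ℕ} (T : TensorSpace n d) (v : Fin d → Fin n → ℝ) :
    inner ℝ T (pureTensor v) = tensorDot T v := by
  rw [tensorDot_apply, PiLp.inner_apply]
  refine Finset.sum_congr rfl fun j _ => ?_
  simp [pureTensor, mul_comm]

theorem tensorDot_comp_perm {n d : ℕ} (T : SymTensor n d) (v : Fin d → Fin n → ℝ)
    (π : Equiv.Perm (Fin d)) : tensorDot T.1 (v ∘ π) = tensorDot T.1 v := by
  rw [tensorDot_apply, tensorDot_apply, ← (Equiv.arrowCongr π.symm (Equiv.refl (Fin n))).sum_comp]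
  refine Finset.sum_congr rfl fun j _ => ?_
  have h1 : (Equiv.arrowCongr π.symm (Equiv.refl (Fin n))) j = j ∘ π := by
    funext k; simp [Equiv.arrowCongr]
  rw [h1, T.2 π j, ← Equiv.prod_comp π fun k => v k (j k)]
  rfl

theorem abs_tensorDot_le {n d : ℕ} (T : SymTensor n d) {v : Fin d → Fin n → ℝ} {B : ℝ}
    (hv : ∀ k a, |v k a| ≤ B) : |tensorDot T.1 v| ≤ (n * B) ^ d * ‖T‖ := by
  rw [tensorDot_apply]
  refine (Finset.abs_sum_le_sum_abs _ _).trans ?_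
  calc _ ≤ ∑ j : Fin d → Fin n, ‖T‖ * B ^ d := by
        refine Finset.sum_le_sum fun j _ => ?_
        rw [abs_mul, Finset.abs_prod]
        refine mul_le_mul ?_ ?_ (Finset.prod_nonneg fun _ _ => abs_nonneg _) (norm_nonneg _)
        · exact PiLp.norm_apply_le T.1 j
        · refine (Finset.prod_le_prod (fun _ _ => abs_nonneg _) fun k _ => hv k (j k)).trans ?_
          simp
    _ = _ := by simp [mul_pow]; ring

theorem tensorEval_eq_sum_tensorDot {n d : ℕ} {ι : Type*} [Fintype ι] (T : TensorSpace n d)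
    (f : (Fin d → ι) → ℝ) (Z : Fin n × ι → ℝ) :
    tensorEval T f Z = ∑ i, f i * tensorDot T (fun k a => Z (a, i k)) := by
  simp only [tensorEval, tensorDot_apply, Finset.mul_sum]
  rw [Finset.sum_comm]
  refine Finset.sum_congr rfl fun i _ => Finset.sum_congr rfl fun j _ => ?_
  ring

/-- Contraction of a symmetric tensor with a vector. -/
noncomputable def contract {n d : ℕ} (v : Fin n → ℝ) :
    SymTensor n (d + 1) →ₗ[ℝ] SymTensor n d :=
  ∑ a, v a • symSlice n d a

theorem contract_apply {n d : ℕ} (v : Fin n → ℝ) (T : SymTensor n (d + 1)) (j : Fin d → Fin n) :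
    (contract v T).1 j = ∑ a, v a * T.1 (Fin.cons a j) := by
  simp [contract, symSlice_apply]

theorem tensorDot_eq_contract {n d : ℕ} (T : SymTensor n (d + 1)) (w : Fin (d + 1) → Fin n → ℝ)
    (k : Fin (d + 1)) :
    tensorDot T.1 w = tensorDot (contract (w k) T).1 (fun l => w (k.succAbove l)) := by
  rw [tensorDot_apply, tensorDot_apply, sum_eq_sum_insertNth _ k, Finset.sum_comm]
  refine Finset.sum_congr rfl fun j _ => ?_
  rw [contract_apply, Finset.sum_mul]
  refine Finset.sum_congr rfl fun a _ => ?_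
  rw [Fin.prod_univ_succAbove _ k, apply_insertNth_of_symmetric (T := T.1.ofLp) T.2]
  simp only [Fin.insertNth_apply_same, Fin.insertNth_apply_succAbove]
  ring

theorem tensorDot_eq_zero_of_contract {n d : ℕ} {T : SymTensor n (d + 1)}
    {w : Fin (d + 1) → Fin n → ℝ} {k : Fin (d + 1)} (h : contract (w k) T = 0) :
    tensorDot T.1 w = 0 := by
  rw [tensorDot_eq_contract T w k, h]
  simp [tensorDot_apply]

/-- In the multilinear expansion every term containing some `u k` vanishes. -/
theorem tensorDot_add_of_contract {n d : ℕ} {T : SymTensor n (d + 1)}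
    {u : Fin (d + 1) → Fin n → ℝ} (h : ∀ k, contract (u k) T = 0) (ρ : ℝ)
    (w : Fin (d + 1) → Fin n → ℝ) :
    tensorDot T.1 (u + fun k => ρ • w k) = ρ ^ (d + 1) * tensorDot T.1 w := by
  rw [MultilinearMap.map_add_univ, Finset.sum_eq_single ∅]
  · rw [Finset.piecewise_empty, MultilinearMap.map_smul_univ]
    simp
  · intro s _ hs
    obtain ⟨k, hk⟩ := Finset.nonempty_iff_ne_empty.2 hs
    refine tensorDot_eq_zero_of_contract (k := k) ?_
    rw [Finset.piecewise_eq_of_mem _ _ _ hk, h]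
  · simp

/-! ### Monotone tuples and symmetric coefficients -/

/-- The nondecreasing rearrangement of a tuple. -/
def sortTuple {m d : ℕ} (i : Fin d → Fin m) : MonoTuple m d :=
  ⟨i ∘ Tuple.sort i, Tuple.monotone_sort i⟩

theorem sortTuple_comp {m d : ℕ} (i : Fin d → Fin m) (π : Equiv.Perm (Fin d)) :
    sortTuple (i ∘ π) = sortTuple i :=
  Subtype.ext Tuple.comp_perm_comp_sort_eq_comp_sort

theorem sortTuple_coe {m d : ℕ} (J : MonoTuple m d) : sortTuple J.1 = J :=
  Subtype.ext (by
    change J.1 ∘ Tuple.sort J.1 = J.1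
    rw [Tuple.sort_eq_refl_iff_monotone.2 J.2]; rfl)

theorem card_sortTuple_fiber_le {m d : ℕ} (J : MonoTuple m d) :
    (Finset.univ.filter fun i : Fin d → Fin m => sortTuple i = J).card ≤ d.factorial := by
  classical
  have hsub : (Finset.univ.filter fun i : Fin d → Fin m => sortTuple i = J) ⊆
      Finset.univ.image fun π : Equiv.Perm (Fin d) => J.1 ∘ π := by
    intro i hi
    rw [Finset.mem_filter] at hi
    refine Finset.mem_image.2 ⟨(Tuple.sort i).symm, Finset.mem_univ _, ?_⟩
    rw [← hi.2]
    funext k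
    simp [sortTuple]
  refine (Finset.card_le_card hsub).trans (Finset.card_image_le.trans ?_)
  rw [Finset.card_univ, Fintype.card_perm, Fintype.card_fin]

/-- Needed because singular values with index beyond the dimension of the domain are zero by
convention. -/
theorem choose_le_card_monoTuple (m d : ℕ) :
    (m + d - 1).choose d ≤ Fintype.card (MonoTuple m d) := by
  have h := Sym.card_sym_eq_choose (α := Fin m) d
  rw [Fintype.card_fin] at h
  rw [← h]
  refine Fintype.card_le_of_surjective
    (fun J : MonoTuple m d => (⟨Finset.univ.val.map J.1, by simp⟩ : Sym (Fin m) d)) ?_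
  rintro ⟨s, hs⟩
  obtain ⟨l, rfl⟩ := Quot.exists_rep s
  have hl : l.length = d := hs
  subst hl
  refine ⟨sortTuple l.get, Subtype.ext ?_⟩
  change Finset.univ.val.map (l.get ∘ Tuple.sort l.get) = _
  rw [← Multiset.map_map]
  have : Finset.univ.val.map (Tuple.sort l.get) = (Finset.univ : Finset (Fin l.length)).val := by
    simp
  rw [this]
  simp [Fin.univ_val_map]

theorem card_monoTuple_le (m d : ℕ) : Fintype.card (MonoTuple m d) ≤ m ^ d := by
  refine (Fintype.card_subtype_le _).trans ?_
  simp

/-- The symmetric array of coefficients on all tuples that corresponds, up to the factor `d!`, to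
coefficients on nondecreasing tuples. -/
noncomputable def symCoeff {m d : ℕ} (b : MonoTuple m d → ℝ) (i : Fin d → Fin m) : ℝ :=
  d.factorial * b (sortTuple i) /
    (Finset.univ.filter fun i' : Fin d → Fin m => sortTuple i' = sortTuple i).card

theorem symCoeff_comp {m d : ℕ} (b : MonoTuple m d → ℝ) (π : Equiv.Perm (Fin d))
    (i : Fin d → Fin m) : symCoeff b (i ∘ π) = symCoeff b i := by
  rw [symCoeff, symCoeff, sortTuple_comp]

/-- The factor `d!` outweighs the number of rearrangements over which the coefficient is spread. -/
theorem one_le_symCoeff {m d : ℕ} {b : MonoTuple m d → ℝ} {I : MonoTuple m d} (hI : b I = 1) :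
    1 ≤ symCoeff b I.1 := by
  rw [symCoeff, sortTuple_coe, hI, mul_one, one_le_div₀]
  · exact_mod_cast card_sortTuple_fiber_le I
  · exact_mod_cast Finset.card_pos.2 ⟨I.1, by simp [sortTuple_coe]⟩

theorem tensorEval_symCoeff {n m d : ℕ} (T : SymTensor n d) (b : MonoTuple m d → ℝ)
    (Z : Fin n × Fin m → ℝ) :
    tensorEval T.1 (symCoeff b) Z =
      d.factorial * ∑ J, b J * tensorDot T.1 (fun k a => Z (a, J.1 k)) := by
  classical
  rw [tensorEval_eq_sum_tensorDot,
    ← Finset.sum_fiberwise_of_maps_to (g := sortTuple) (t := Finset.univ) (by simp),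
    Finset.mul_sum]
  refine Finset.sum_congr rfl fun J _ => ?_
  have h : ∀ i ∈ Finset.univ.filter (fun i : Fin d → Fin m => sortTuple i = J),
      symCoeff b i * tensorDot T.1 (fun k a => Z (a, i k)) = d.factorial * b J /
        (Finset.univ.filter fun i' : Fin d → Fin m => sortTuple i' = J).card *
          tensorDot T.1 (fun k a => Z (a, J.1 k)) := by
    intro i hi
    have hiJ := (Finset.mem_filter.1 hi).2
    rw [symCoeff, hiJ, ← tensorDot_comp_perm T (fun k a => Z (a, i k)) (Tuple.sort i), ← hiJ]
    rfl
  rw [Finset.sum_congr rfl h, Finset.sum_const, nsmul_eq_mul]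
  have hne : ((Finset.univ.filter fun i' : Fin d → Fin m => sortTuple i' = J).card : ℝ) ≠ 0 := by
    have : 0 < (Finset.univ.filter fun i' : Fin d → Fin m => sortTuple i' = J).card :=
      Finset.card_pos.2 ⟨J.1, by simp [sortTuple_coe]⟩
    exact_mod_cast this.ne'
  field_simp

/-! ### From a small singular value to a near-dependence -/

theorem exists_norm_eq_sigma {E F : Type*} [NormedAddCommGroup E] [InnerProductSpace ℝ E]
    [FiniteDimensional ℝ E] [NormedAddCommGroup F] [InnerProductSpace ℝ F]
    [FiniteDimensional ℝ F] (T : E →ₗ[ℝ] F) {k : ℕ} (hk : k - 1 < Module.finrank ℝ E) :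
    ∃ x : E, ‖x‖ = 1 ∧ ‖T x‖ = sigma k T := by
  have hS := T.isSymmetric_adjoint_comp_self
  refine ⟨hS.eigenvectorBasis rfl ⟨k - 1, hk⟩, (hS.eigenvectorBasis rfl).orthonormal.1 _, ?_⟩
  have h0 : 0 ≤ sigma k T := T.singularValues_nonneg _
  have h1 : sigma k T ^ 2 = _ := T.sq_singularValues_of_lt rfl hk
  rw [← sq_eq_sq₀ (norm_nonneg _) h0, h1, ← real_inner_self_eq_norm_sq,
    ← LinearMap.adjoint_inner_right, ← LinearMap.comp_apply, hS.apply_eigenvectorBasis]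
  simp [inner_smul_right]

theorem inner_symKronecker {n m d : ℕ} (V : Matrix (Fin n) (Fin m) ℝ) (T : SymTensor n d)
    (x : EuclideanSpace ℝ (MonoTuple m d)) :
    inner ℝ T (symKronecker d V x) =
      ∑ J, x J * tensorDot T.1 (fun k a => V a (J.1 k)) := by
  change inner ℝ T (∑ J, x J • symKroneckerColumn d V J) = _
  rw [inner_sum]
  refine Finset.sum_congr rfl fun J _ => ?_
  refine (inner_smul_right (𝕜 := ℝ) T (symKroneckerColumn d V J) (x J)).trans
    (congrArg (fun y => x J * y) ?_)
  rw [← inner_pureTensor]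
  change inner ℝ T ((SymTensor n d).orthogonalProjectionOnto _) = _
  rw [Submodule.inner_orthogonalProjectionOnto_eq_of_mem_left]
  rfl

/-- Small singular values give coefficients bounded by one, one of them equal to one, for which
the combination of the columns is nearly orthogonal to the range of `Φ`. -/
theorem exists_coeff_of_sigma_lt {n m d : ℕ} (V : Matrix (Fin n) (Fin m) ℝ) (hm : 0 < m)
    {Φ : SymTensor n d →ₗ[ℝ] SymTensor n d} (hΦ : Φ.IsSymmetricProjection) {t : ℝ}
    (h : sigma ((m + d - 1).choose d) (Φ ∘ₗ symKronecker d V) < t) :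
    ∃ (I : MonoTuple m d) (x : MonoTuple m d → ℝ), x I = 1 ∧ (∀ J, |x J| ≤ 1) ∧
      ∀ T ∈ LinearMap.range Φ, |∑ J, x J * tensorDot T.1 (fun k a => V a (J.1 k))| ≤
        t * (m : ℝ) ^ d * ‖T‖ := by
  have hfin : Module.finrank ℝ (EuclideanSpace ℝ (MonoTuple m d)) =
      Fintype.card (MonoTuple m d) := by simp
  have hle := choose_le_card_monoTuple m d
  have hpos : 0 < (m + d - 1).choose d := Nat.choose_pos (by omega)
  obtain ⟨x, hx1, hx⟩ := exists_norm_eq_sigma (Φ ∘ₗ symKronecker d V)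
    (k := (m + d - 1).choose d) (by rw [hfin]; omega)
  rw [← hx] at h
  have hne : Nonempty (MonoTuple m d) := Fintype.card_pos_iff.1 (by omega)
  obtain ⟨I, -, hI⟩ := Finset.exists_max_image (Finset.univ : Finset (MonoTuple m d))
    (fun J => |x J|) Finset.univ_nonempty
  -- A unit vector with at most `m ^ d` coordinates has `m ^ d * |x I| ^ 2 ≥ 1` at its largest one,
  -- and `|x I| ≤ 1` removes the square.
  have hcard : (1 : ℝ) ≤ (m : ℝ) ^ d * |x I| := by
    have h1 : ∑ J, |x J| ^ 2 = 1 := by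
      have := EuclideanSpace.norm_sq_eq x
      rw [hx1, one_pow] at this
      simpa using this.symm
    have h2 : (1 : ℝ) ≤ (m : ℝ) ^ d * |x I| ^ 2 := by
      calc (1 : ℝ) = ∑ J, |x J| ^ 2 := h1.symm
        _ ≤ ∑ J : MonoTuple m d, |x I| ^ 2 := by
            refine Finset.sum_le_sum fun J _ => ?_
            exact pow_le_pow_left₀ (abs_nonneg _) (hI J (Finset.mem_univ _)) 2
        _ = (Fintype.card (MonoTuple m d) : ℝ) * |x I| ^ 2 := by
            rw [Finset.sum_const, Finset.card_univ, nsmul_eq_mul]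
        _ ≤ _ := by
            have : (Fintype.card (MonoTuple m d) : ℝ) ≤ (m : ℝ) ^ d := by
              exact_mod_cast card_monoTuple_le m d
            gcongr
    have h3 : |x I| ≤ 1 := by rw [← hx1]; exact PiLp.norm_apply_le x I
    have h4 : (0 : ℝ) ≤ (m : ℝ) ^ d := by positivity
    nlinarith [abs_nonneg (x I), mul_le_mul_of_nonneg_left h3 (mul_nonneg h4 (abs_nonneg (x I)))]
  have hI0 : 0 < |x I| := by
    by_contra h0
    have : |x I| = 0 := le_antisymm (not_lt.1 h0) (abs_nonneg _)
    rw [this, mul_zero] at hcard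
    linarith
  refine ⟨I, fun J => x J / x I, div_self (abs_pos.1 hI0), fun J => ?_, fun T hT => ?_⟩
  · rw [abs_div, div_le_one hI0]
    exact hI J (Finset.mem_univ _)
  · have hΦT : Φ T = T := by
      obtain ⟨S, rfl⟩ := hT
      exact LinearMap.congr_fun hΦ.1 S
    have h1 : ∑ J, x J / x I * tensorDot T.1 (fun k a => V a (J.1 k)) =
        inner ℝ T (Φ (symKronecker d V x)) / x I := by
      rw [← hΦ.2 T, hΦT, inner_symKronecker, Finset.sum_div]
      exact Finset.sum_congr rfl fun J _ => by ring
    rw [h1, abs_div, div_le_iff₀ hI0]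
    have h2 := (abs_real_inner_le_norm T (Φ (symKronecker d V x)))
    have h3 : ‖Φ (symKronecker d V x)‖ ≤ t := h.le
    have ht : 0 ≤ t := (norm_nonneg _).trans h3
    calc _ ≤ ‖T‖ * t := h2.trans (by gcongr)
      _ ≤ ‖T‖ * t * ((m : ℝ) ^ d * |x I|) :=
          le_mul_of_one_le_right (by positivity) hcard
      _ = _ := by ring

/-! ### The Gaussian noise as a scaled standard array -/

theorem pi_pi_map_eq_map (n m : ℕ) (ν : Measure ℝ) [IsProbabilityMeasure ν] {f : ℝ → ℝ}
    (hf : Measurable f) :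
    Measure.pi (fun _ : Fin n => Measure.pi fun _ : Fin m => ν.map f) =
      (Measure.pi fun _ : Fin n × Fin m => ν).map fun Z a c => f (Z (a, c)) := by
  have := Measure.isProbabilityMeasure_map (μ := ν) hf.aemeasurable
  have hmeas : Measurable fun (Z : Fin n × Fin m → ℝ) (a : Fin n) (c : Fin m) => f (Z (a, c)) := by
    fun_prop
  refine Measure.pi_eq_generateFrom (C := fun _ => Set.pi Set.univ ''
    Set.pi Set.univ fun _ => {s : Set ℝ | MeasurableSet s})
    (fun _ => generateFrom_pi) (fun _ => isPiSystem_pi)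
    (fun _ => ⟨fun _ => Set.univ, fun _ => ⟨fun _ => Set.univ, by simp, by simp⟩,
      fun _ => measure_lt_top _ _, Set.iUnion_const _⟩) fun s hs => ?_
  choose t ht hts using hs
  have htm : ∀ a c, MeasurableSet (t a c) := fun a c => ht a c (Set.mem_univ c)
  have hsm : ∀ a, MeasurableSet (s a) := fun a => by
    rw [← hts a]; exact MeasurableSet.univ_pi (htm a)
  rw [Measure.map_apply hmeas (MeasurableSet.univ_pi hsm)]
  have hpre : (fun (Z : Fin n × Fin m → ℝ) (a : Fin n) (c : Fin m) => f (Z (a, c))) ⁻¹'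
      Set.univ.pi s = Set.univ.pi fun p : Fin n × Fin m => f ⁻¹' t p.1 p.2 := by
    ext Z
    simp only [Set.mem_preimage, Set.mem_univ_pi, ← hts, Prod.forall]
  rw [hpre, Measure.pi_pi, Fintype.prod_prod_type]
  refine Finset.prod_congr rfl fun a _ => ?_
  rw [← hts a, Measure.pi_pi]
  exact Finset.prod_congr rfl fun c _ => (Measure.map_apply hf (htm a c)).symm

theorem gaussianNoise_eq_map (n m : ℕ) (ρ : ℝ) :
    gaussianNoise n m ρ =
      (stdGaussianArray (Fin n × Fin m)).map fun Z a c => ρ * Z (a, c) := by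
  have h := gaussianReal_map_const_mul (μ := 0) (v := 1) ρ
  rw [mul_zero, mul_one] at h
  rw [stdGaussianArray, ← pi_pi_map_eq_map n m _ (measurable_const_mul ρ)]
  change _ = Measure.pi (fun _ : Fin n => Measure.pi fun _ : Fin m =>
    (gaussianReal 0 1).map (fun x => ρ * x))
  rw [h]
  rfl

theorem stdGaussianArray_real_exists_gt {κ : Type*} [Fintype κ] {r : ℝ} (hr : 0 ≤ r) :
    (stdGaussianArray κ).real {Z | ∃ p, r < |Z p|} ≤
      Fintype.card κ * (2 * Real.exp (-(r ^ 2 / 2))) := by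
  have h : {Z : κ → ℝ | ∃ p, r < |Z p|} = ⋃ p, {Z | r < |Z p|} := by ext; simp
  rw [h]
  refine (measureReal_iUnion_fintype_le _).trans ?_
  calc _ ≤ ∑ p : κ, 2 * Real.exp (-(r ^ 2 / 2)) := by
        refine Finset.sum_le_sum fun p _ => ?_
        refine le_trans (le_of_eq ?_) (gaussianReal_real_abs_gt_exp hr)
        exact (measurePreserving_eval (fun _ : κ => gaussianReal 0 1) p).measureReal_preimage
          (measurableSet_lt measurable_const measurable_id.abs).nullMeasurableSet
    _ = _ := by simp

/-! ### Near-dependences with a fixed leading tuple -/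

/-- The Gaussian arrays, with entries bounded by `B`, for which some combination of the columns of
the perturbed matrix in which `I` has coefficient one has small projection to `W`. -/
def nearDependentSet {n m d : ℕ} (W : Submodule ℝ (SymTensor n d)) (U : Fin m → Fin n → ℝ)
    (ρ t B : ℝ) (I : MonoTuple m d) : Set (Fin n × Fin m → ℝ) :=
  {Z | (∀ p, |Z p| ≤ B) ∧ ∃ x : MonoTuple m d → ℝ, x I = 1 ∧ (∀ J, |x J| ≤ 1) ∧
    ∀ T ∈ W, |∑ J, x J * tensorDot T.1
      ((fun k => U (J.1 k)) + fun k => ρ • fun a => Z (a, J.1 k))| ≤ t * ‖T‖}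

/-- The coefficients range over a compact set, so the event is the projection of a closed set along
a compact factor, hence closed. -/
theorem measurableSet_nearDependentSet {n m d : ℕ} (W : Submodule ℝ (SymTensor n d))
    (U : Fin m → Fin n → ℝ) (ρ t B : ℝ) (I : MonoTuple m d) :
    MeasurableSet (nearDependentSet W U ρ t B I) := by
  set K : Set (MonoTuple m d → ℝ) := {x | x I = 1 ∧ ∀ J, |x J| ≤ 1} with hK
  have hKc : IsCompact K := by
    refine (isCompact_univ_pi fun _ => isCompact_Icc (a := (-1 : ℝ)) (b := 1)).of_isClosed_subset
      ?_ ?_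
    · have : K = {x | x I = 1} ∩ ⋂ J, {x | |x J| ≤ 1} := by
        ext x; simp [hK]
      rw [this]
      exact (isClosed_eq (by fun_prop) continuous_const).inter
        (isClosed_iInter fun J => isClosed_le (by fun_prop) continuous_const)
    · intro x hx J _
      exact abs_le.1 (hx.2 J)
  have : CompactSpace K := isCompact_iff_compactSpace.1 hKc
  set C : Set (K × (Fin n × Fin m → ℝ)) := {p | (∀ q, |p.2 q| ≤ B) ∧
    ∀ T ∈ W, |∑ J, p.1.1 J * tensorDot T.1
      ((fun k => U (J.1 k)) + fun k => ρ • fun a => p.2 (a, J.1 k))| ≤ t * ‖T‖} with hC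
  have hCc : IsClosed C := by
    have : C = (⋂ q, {p | |p.2 q| ≤ B}) ∩ ⋂ T ∈ W, {p | |∑ J, p.1.1 J * tensorDot T.1
      ((fun k => U (J.1 k)) + fun k => ρ • fun a => p.2 (a, J.1 k))| ≤ t * ‖T‖} := by
      ext p; simp [hC]
    rw [this]
    refine (isClosed_iInter fun q => isClosed_le (by fun_prop) continuous_const).inter
      (isClosed_biInter fun T _ => isClosed_le ?_ continuous_const)
    simp only [tensorDot_apply, Pi.add_apply, Pi.smul_apply]
    refine (continuous_finsetSum _ fun J _ => Continuous.mul ?_ ?_).abs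
    · exact (continuous_apply J).comp (continuous_subtype_val.comp continuous_fst)
    · fun_prop
  have hE : nearDependentSet W U ρ t B I = Prod.snd '' C := by
    ext Z
    constructor
    · rintro ⟨hB, x, hx1, hx2, hx3⟩
      exact ⟨(⟨x, hx1, hx2⟩, Z), ⟨hB, hx3⟩, rfl⟩
    · rintro ⟨⟨x, Z⟩, ⟨hB, hx⟩, rfl⟩
      exact ⟨hB, x.1, x.2.1, x.2.2, hx⟩
  rw [hE]
  exact (isClosedMap_snd_of_compactSpace C hCc).measurableSet

/-- Rounding down to the grid fixes the value 1, so the normalization `x I = 1` survives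
discretization. -/
theorem exists_grid_near {L : ℕ} (hL : 0 < L) {x : ℝ} (hx : |x| ≤ 1) :
    ∃ b : Fin (2 * L + 1), |x - ((b : ℕ) - L : ℝ) / L| ≤ 1 / L ∧
      (x = 1 → ((b : ℕ) - L : ℝ) / L = 1) := by
  have hL' : (0 : ℝ) < L := by exact_mod_cast hL
  obtain ⟨h1, h2⟩ := abs_le.1 hx
  have h0 : 0 ≤ (x + 1) * L := by nlinarith
  have hfl : ⌊(x + 1) * L⌋₊ < 2 * L + 1 := by
    rw [Nat.floor_lt h0]
    push_cast
    nlinarith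
  refine ⟨⟨_, hfl⟩, ?_, ?_⟩
  swap
  · rintro rfl
    have h1 : ((1 : ℝ) + 1) * L = ((2 * L : ℕ) : ℝ) := by push_cast; ring
    simp only [h1, Nat.floor_natCast]
    push_cast
    field_simp
    ring
  have h3 := Nat.floor_le h0
  have h4 := Nat.lt_floor_add_one ((x + 1) * L)
  have : x - ((⌊(x + 1) * L⌋₊ : ℝ) - L) / L = ((x + 1) * L - ⌊(x + 1) * L⌋₊) / L := by
    field_simp; ring
  rw [this, abs_of_nonneg (div_nonneg (by linarith) hL'.le)]
  gcongr
  linarith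

/-- The symmetric tensors killed by contraction with all the vectors `v p`. -/
noncomputable def killedBy {n d : ℕ} {ι : Type*} (v : ι → Fin n → ℝ) :
    Submodule ℝ (SymTensor n (d + 1)) :=
  LinearMap.ker (LinearMap.pi fun p : ι => contract (v p))

theorem mem_killedBy {n d : ℕ} {ι : Type*} {v : ι → Fin n → ℝ} {T : SymTensor n (d + 1)} :
    T ∈ killedBy v ↔ ∀ p, contract (v p) T = 0 := by
  rw [killedBy, LinearMap.mem_ker, funext_iff]
  rfl

theorem finrank_le_finrank_inf_killedBy {n d : ℕ} {ι : Type*} [Fintype ι] (v : ι → Fin n → ℝ)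
    (W : Submodule ℝ (SymTensor n (d + 1))) :
    Module.finrank ℝ W ≤ Module.finrank ℝ (W ⊓ killedBy v : Submodule ℝ (SymTensor n (d + 1))) +
      Fintype.card ι * n ^ d := by
  refine (finrank_le_finrank_inf_ker (LinearMap.pi fun p : ι => contract (v p)) W).trans ?_
  refine Nat.add_le_add_left ?_ _
  rw [Module.finrank_pi_fintype, Finset.sum_const, Finset.card_univ, smul_eq_mul]
  exact Nat.mul_le_mul_left _ (finrank_symTensor_le n d)

/-- Such a `J` factors as `I ∘ g`. The bound is free of `m`, which keeps the net polynomial in `n`.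
-/
theorem card_tuples_in_range_le {m d : ℕ} (I : MonoTuple m d) :
    Nat.card {J : MonoTuple m d // Set.range J.1 ⊆ Set.range I.1} ≤ d ^ d := by
  have : ∀ J : {J : MonoTuple m d // Set.range J.1 ⊆ Set.range I.1},
      ∃ g : Fin d → Fin d, ∀ k, I.1 (g k) = J.1.1 k := fun J =>
    ⟨fun k => (J.2 ⟨k, rfl⟩).choose, fun k => (J.2 ⟨k, rfl⟩).choose_spec⟩
  choose g hg using this
  refine (Nat.card_le_card_of_injective g fun J J' h => ?_).trans (by simp)
  refine Subtype.ext (Subtype.ext (funext fun k => ?_))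
  rw [← hg, h, hg]

theorem contract_add_smul {n d : ℕ} (u v : Fin n → ℝ) (ρ : ℝ) (T : SymTensor n (d + 1)) :
    contract (u + ρ • v) T = contract u T + ρ • contract v T := by
  simp [contract, add_smul, mul_smul, Finset.sum_add_distrib, Finset.smul_sum]

theorem tensorDot_perturbed {n m d : ℕ} {U : Fin m → Fin n → ℝ} {T : SymTensor n (d + 1)}
    {S : Set (Fin m)} [DecidablePred (· ∈ S)] {ρ : ℝ} {Z : Fin n × Fin m → ℝ}
    (hU : ∀ c, contract (U c) T = 0) (hZ : ∀ c ∉ S, contract (fun a => Z (a, c)) T = 0)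
    (J : Fin (d + 1) → Fin m) [Decidable (Set.range J ⊆ S)] :
    tensorDot T.1 ((fun k => U (J k)) + fun k => ρ • fun a => Z (a, J k)) =
      if Set.range J ⊆ S then ρ ^ (d + 1) * tensorDot T.1 (fun k a => Z (a, J k)) else 0 := by
  split_ifs with h
  · exact tensorDot_add_of_contract (fun k => hU (J k)) ρ _
  · rw [Set.range_subset_iff, not_forall] at h
    obtain ⟨k, hk⟩ := h
    refine tensorDot_eq_zero_of_contract (k := k) ?_
    change contract (U (J k) + ρ • fun a => Z (a, J k)) T = 0
    rw [contract_add_smul, hU, hZ _ hk, smul_zero, add_zero]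

/-- With the columns outside `I` frozen to `y`, tensors of `W'` see only Gaussian columns of `I`.
Rounding the surviving coefficients puts the event in a union of small-projection events, each
bounded by `smallProjSet_real_le`. Hypothesis `ht` splits the threshold between `t` and the rounding
error. -/
theorem nearDependentSet_real_le {n m d k L : ℕ} (hn : 0 < n) (hk : 0 < k) (hL : 0 < L)
    {r η ρ t B : ℝ} (hr : 1 ≤ r) (hη : 0 < η) (hDr : 2 * (d + 1 : ℕ) + 4 ≤ r)
    (hηr : η * (((d + 1 : ℕ) + 1) * ((d + 1 : ℕ) * (2 * r * r) ^ (d + 1))) ≤ 1 / (2 * n))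
    (hρ : 0 < ρ) (hB : 0 ≤ B)
    (ht : (d + 1).factorial * (t / ρ ^ (d + 1) +
      ((d + 1) ^ (d + 1) : ℕ) * ((n * B) ^ (d + 1) / L)) ≤ η ^ (d + 1) / 2)
    (W : Submodule ℝ (SymTensor n (d + 1)))
    (hW : 3 ^ (d + 1) * k * n ^ (d + 1) + n * ((m + m) * n ^ d) ≤ n * Module.finrank ℝ W)
    (U : Fin m → Fin n → ℝ) (I : MonoTuple m (d + 1)) :
    (stdGaussianArray (Fin n × Fin m)).real (nearDependentSet W U ρ t B I) ≤
      ((2 * L + 1) ^ ((d + 1) ^ (d + 1)) : ℕ) *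
        ((d + 1 : ℕ) * (k : ℝ) ^ (d + 1) * ((2 * (d + 1 : ℕ) + 4) / r) ^ k) := by
  classical
  set P : ℝ := (d + 1 : ℕ) * (k : ℝ) ^ (d + 1) * ((2 * (d + 1 : ℕ) + 4) / r) ^ k with hP
  have hP0 : 0 ≤ P := by positivity
  have hL' : (0 : ℝ) < L := by exact_mod_cast hL
  rw [← mul_one (_ * P), ← probReal_univ (μ := stdGaussianArray (Fin n × Fin m))]
  refine pi_real_le_of_slices (fun _ => gaussianReal 0 1) {p | p.2 ∈ Set.range I.1}
    (measurableSet_nearDependentSet W U ρ t B I) MeasurableSet.univ (Set.subset_univ _)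
    (fun _ _ _ => Set.mem_univ _) (by positivity) fun y => ?_
  -- The zero vector at the columns of `I` imposes no condition: those columns stay random, and `W'`
  -- must not depend on them.
  set v : Fin m ⊕ Fin m → Fin n → ℝ :=
    Sum.elim U fun c => if c ∈ Set.range I.1 then 0 else fun a => y (a, c) with hv
  set W' := W ⊓ killedBy v with hW'
  set A := {J : MonoTuple m (d + 1) // Set.range J.1 ⊆ Set.range I.1}
  set β : (A → Fin (2 * L + 1)) → MonoTuple m (d + 1) → ℝ := fun b J =>
    if h : Set.range J.1 ⊆ Set.range I.1 then (((b ⟨J, h⟩ : Fin (2 * L + 1)) : ℕ) - L : ℝ) / L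
      else 0 with hβ
  -- Net points with coefficient at `I` other than 1 give the empty set, so every `G b` obeys the
  -- same bound.
  set G : (A → Fin (2 * L + 1)) → Set (Fin n × Fin m → ℝ) := fun b =>
    {x | β b I = 1 ∧ x ∈ smallProjSet W' (symCoeff (β b)) (η ^ (d + 1) / 2)} with hG
  have hdim : 3 ^ (d + 1) * k * n ^ (d + 1) ≤ n * Module.finrank ℝ W' := by
    have h1 := finrank_le_finrank_inf_killedBy v W
    rw [Fintype.card_sum, Fintype.card_fin] at h1
    have h2 := Nat.mul_le_mul_left n h1
    rw [Nat.mul_add] at h2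
    exact Nat.le_of_add_le_add_right (hW.trans h2)
  have hGP : ∀ b, (stdGaussianArray (Fin n × Fin m)).real (G b) ≤ P := by
    intro b
    by_cases hb : β b I = 1
    · refine (measureReal_mono (s₂ := smallProjSet W' (symCoeff (β b)) (η ^ (d + 1) / 2))
        fun x hx => hx.2).trans ?_
      exact smallProjSet_real_le hn hk hr hη hDr hηr (d + 1) le_rfl W' _ hdim (symCoeff_comp _)
        ⟨I.1, (one_le_symCoeff hb).trans (le_abs_self _)⟩
    · have : G b = ∅ := by
        ext x
        simp [hG, hb]
      rw [this, measureReal_empty]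
      exact hP0
  have hcardA : Fintype.card A ≤ (d + 1) ^ (d + 1) := by
    rw [← Nat.card_eq_fintype_card]
    exact card_tuples_in_range_le I
  have hsub : {x | Set.piecewise {p : Fin n × Fin m | p.2 ∈ Set.range I.1} x y ∈
      nearDependentSet W U ρ t B I} ⊆ ⋃ b, G b := by
    intro x hx
    set Z := Set.piecewise {p : Fin n × Fin m | p.2 ∈ Set.range I.1} x y with hZ
    obtain ⟨hZB, ξ, hξI, hξ, hT⟩ := hx
    choose g hg1 hg2 using fun J : A => exists_grid_near hL (hξ J.1)
    have hβI : β g I = 1 := by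
      simp only [hβ, subset_rfl, dif_pos]
      exact hg2 ⟨I, subset_rfl⟩ hξI
    refine Set.mem_iUnion.2 ⟨g, hβI, fun T hTW => ?_⟩
    have hkill := mem_killedBy.1 hTW.2
    have hU : ∀ c, contract (U c) T = 0 := fun c => hkill (Sum.inl c)
    have hZc : ∀ c ∉ Set.range I.1, contract (fun a => Z (a, c)) T = 0 := by
      intro c hc
      have h := hkill (Sum.inr c)
      simp only [hv, Sum.elim_inr, if_neg hc] at h
      have h2 : (fun a => Z (a, c)) = fun a => y (a, c) := by
        funext a
        exact Set.piecewise_eq_of_notMem _ _ _ hc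
      rw [h2, h]
    have hxZ : ∀ J : MonoTuple m (d + 1), Set.range J.1 ⊆ Set.range I.1 →
        (fun (l : Fin (d + 1)) (a : Fin n) => x (a, J.1 l)) = fun l a => Z (a, J.1 l) := by
      intro J hJ
      funext l a
      exact (Set.piecewise_eq_of_mem _ _ _
        (show (a, J.1 l) ∈ {p : Fin n × Fin m | p.2 ∈ Set.range I.1} from hJ ⟨l, rfl⟩)).symm
    have hmain := hT T hTW.1
    have hsum : ∑ J : MonoTuple m (d + 1), ξ J * tensorDot T.1
        ((fun k => U (J.1 k)) + fun k => ρ • fun a => Z (a, J.1 k)) = ρ ^ (d + 1) *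
        ∑ J : MonoTuple m (d + 1), if Set.range J.1 ⊆ Set.range I.1 then
          ξ J * tensorDot T.1 (fun l a => Z (a, J.1 l)) else 0 := by
      rw [Finset.mul_sum]
      refine Finset.sum_congr rfl fun J _ => ?_
      rw [tensorDot_perturbed hU hZc]
      split_ifs
      · ring
      · simp
    rw [hsum, abs_mul, abs_of_pos (pow_pos hρ _), ← le_div_iff₀' (pow_pos hρ _)] at hmain
    have hdiff : |(∑ J, β g J * tensorDot T.1 (fun l a => x (a, J.1 l))) -
        ∑ J : MonoTuple m (d + 1), if Set.range J.1 ⊆ Set.range I.1 then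
          ξ J * tensorDot T.1 (fun l a => Z (a, J.1 l)) else 0| ≤
        ((d + 1) ^ (d + 1) : ℕ) * ((n * B) ^ (d + 1) / L) * ‖T‖ := by
      rw [← Finset.sum_sub_distrib]
      refine (Finset.abs_sum_le_sum_abs _ _).trans ?_
      calc _ ≤ ∑ J : MonoTuple m (d + 1), if Set.range J.1 ⊆ Set.range I.1 then
            (n * B) ^ (d + 1) / L * ‖T‖ else 0 := by
            refine Finset.sum_le_sum fun J _ => ?_
            by_cases hJ : Set.range J.1 ⊆ Set.range I.1
            · rw [if_pos hJ, if_pos hJ, hxZ J hJ, ← sub_mul, abs_mul, abs_sub_comm]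
              have h1 : |ξ J - β g J| ≤ 1 / L := by
                simp only [hβ, hJ, dif_pos]
                exact hg1 ⟨J, hJ⟩
              have h2 := abs_tensorDot_le T (v := fun l a => Z (a, J.1 l)) (B := B)
                fun l a => hZB _
              calc _ ≤ 1 / L * ((n * B) ^ (d + 1) * ‖T‖) := by gcongr
                _ = _ := by ring
            · have : β g J = 0 := by simp only [hβ, hJ, dif_neg, not_false_eq_true]
              simp [hJ, this]
        _ = Fintype.card A * ((n * B) ^ (d + 1) / L * ‖T‖) := by
            rw [← Finset.sum_filter, Finset.sum_const, nsmul_eq_mul, Fintype.card_subtype]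
        _ ≤ ((d + 1) ^ (d + 1) : ℕ) * ((n * B) ^ (d + 1) / L * ‖T‖) := by gcongr
        _ = _ := by ring
    rw [tensorEval_symCoeff, abs_mul, Nat.abs_cast]
    have htri := abs_sub_abs_le_abs_sub
      (∑ J, β g J * tensorDot T.1 (fun l a => x (a, J.1 l)))
      (∑ J : MonoTuple m (d + 1), if Set.range J.1 ⊆ Set.range I.1 then
          ξ J * tensorDot T.1 (fun l a => Z (a, J.1 l)) else 0)
    calc _ ≤ ((d + 1).factorial : ℝ) * (t * ‖T‖ / ρ ^ (d + 1) +
          ((d + 1) ^ (d + 1) : ℕ) * ((n * B) ^ (d + 1) / L) * ‖T‖) := by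
            gcongr
            linarith
      _ = (d + 1).factorial * (t / ρ ^ (d + 1) +
          ((d + 1) ^ (d + 1) : ℕ) * ((n * B) ^ (d + 1) / L)) * ‖T‖ := by ring
      _ ≤ _ := by gcongr
  refine (measureReal_mono hsub).trans ((measureReal_iUnion_fintype_le _).trans ?_)
  calc _ ≤ ∑ b : A → Fin (2 * L + 1), P := Finset.sum_le_sum fun b _ => hGP b
    _ = ((2 * L + 1) ^ Fintype.card A : ℕ) * P := by
        rw [Finset.sum_const, nsmul_eq_mul, Finset.card_univ, Fintype.card_fun, Fintype.card_fin]
    _ ≤ _ := by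
        gcongr
        omega

/-! ### Union bound and choice of parameters -/

theorem one_sub_le_gaussianNoise_sigma {n m d : ℕ} (hm : 0 < m) (U : Matrix (Fin n) (Fin m) ℝ)
    {Φ : SymTensor n d →ₗ[ℝ] SymTensor n d} (hΦ : Φ.IsSymmetricProjection) {ρ t' t P : ℝ}
    (htt : t' * (m : ℝ) ^ d ≤ t)
    (hP : ∀ I : MonoTuple m d, (stdGaussianArray (Fin n × Fin m)).real
      (nearDependentSet (LinearMap.range Φ) (fun c a => U a c) ρ t n I) ≤ P) :
    1 - ((m : ℝ) ^ d * P + n * m * (2 * Real.exp (-((n : ℝ) ^ 2 / 2)))) ≤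
      (gaussianNoise n m ρ).real
        {Z | t' ≤ sigma ((m + d - 1).choose d) (Φ ∘ₗ symKronecker d (U + Matrix.of Z))} := by
  set γ := stdGaussianArray (Fin n × Fin m)
  set g : (Fin n × Fin m → ℝ) → Fin n → Fin m → ℝ := fun Z a c => ρ * Z (a, c) with hg
  set S : Set (Fin n → Fin m → ℝ) :=
    {Z | t' ≤ sigma ((m + d - 1).choose d) (Φ ∘ₗ symKronecker d (U + Matrix.of Z))} with hS
  have hgm : Measurable g := by fun_prop
  set N := (⋃ I : MonoTuple m d,
    nearDependentSet (LinearMap.range Φ) (fun c a => U a c) ρ t n I) ∪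
      {Z : Fin n × Fin m → ℝ | ∃ p, (n : ℝ) < |Z p|} with hN
  have hNm : MeasurableSet N := by
    refine (MeasurableSet.iUnion fun I => measurableSet_nearDependentSet _ _ _ _ _ I).union ?_
    have : {Z : Fin n × Fin m → ℝ | ∃ p, (n : ℝ) < |Z p|} = ⋃ p, {Z | (n : ℝ) < |Z p|} := by
      ext; simp
    rw [this]
    exact MeasurableSet.iUnion fun p => measurableSet_lt measurable_const (by fun_prop)
  have hsub : Nᶜ ⊆ g ⁻¹' S := by
    intro Z hZ
    by_contra hlt
    simp only [Set.mem_preimage, hS, Set.mem_ofPred_eq, not_le] at hlt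
    obtain ⟨I, x, hxI, hx, hT⟩ := exists_coeff_of_sigma_lt _ hm hΦ hlt
    refine hZ ?_
    by_cases hB : ∃ p, (n : ℝ) < |Z p|
    · exact Or.inr hB
    · push Not at hB
      refine Or.inl (Set.mem_iUnion.2 ⟨I, hB, x, hxI, hx, fun T hTΦ => ?_⟩)
      refine (hT T hTΦ).trans ?_
      gcongr
  have hNP : γ.real N ≤ (m : ℝ) ^ d * P + n * m * (2 * Real.exp (-((n : ℝ) ^ 2 / 2))) := by
    refine (measureReal_union_le _ _).trans (add_le_add ?_ ?_)
    · refine (measureReal_iUnion_fintype_le _).trans ((Finset.sum_le_sum fun I _ => hP I).trans ?_)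
      rw [Finset.sum_const, nsmul_eq_mul, Finset.card_univ]
      have hP0 : 0 ≤ P ∨ IsEmpty (MonoTuple m d) := by
        rcases isEmpty_or_nonempty (MonoTuple m d) with h | ⟨⟨I⟩⟩
        · exact Or.inr h
        · exact Or.inl (measureReal_nonneg.trans (hP I))
      have hI : 0 ≤ P := by
        rcases hP0 with h | h
        · exact h
        · exact (h.false ⟨fun _ => ⟨0, hm⟩, monotone_const⟩).elim
      have hc : (Fintype.card (MonoTuple m d) : ℝ) ≤ (m : ℝ) ^ d := by
        exact_mod_cast card_monoTuple_le m d
      gcongr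
    · refine (stdGaussianArray_real_exists_gt (Nat.cast_nonneg n)).trans (le_of_eq ?_)
      simp
  have h1 : γ.real Nᶜ = 1 - γ.real N := probReal_compl_eq_one_sub hNm
  -- This direction holds for arbitrary sets, so measurability of `S` is not needed.
  have h2 : γ.real (g ⁻¹' S) ≤ (γ.map g).real S := by
    have := Measure.isProbabilityMeasure_map (μ := γ) hgm.aemeasurable
    exact ENNReal.toReal_mono (measure_ne_top _ _) (Measure.le_map_apply hgm.aemeasurable S)
  rw [gaussianNoise_eq_map]
  linarith [measureReal_mono (μ := γ) hsub]

theorem pow_le_factorial_mul_choose (n d : ℕ) :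
    n ^ d ≤ d.factorial * (n + d - 1).choose d := by
  rw [← Nat.ascFactorial_eq_factorial_mul_choose']
  exact Nat.pow_succ_le_ascFactorial n d

theorem mul_exp_neg_sq_le {n : ℝ} (hn : 12 ≤ n) :
    n * n * (2 * Real.exp (-(n ^ 2 / 2))) ≤ Real.exp (-n) / 2 := by
  have h1 := Real.quadratic_le_exp_of_nonneg (x := n ^ 2 / 2 - n) (by nlinarith)
  have h2 : 4 * n ^ 2 ≤ Real.exp (n ^ 2 / 2 - n) := by
    have : 5 * n ≤ n ^ 2 / 2 - n := by nlinarith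
    nlinarith
  have h3 : Real.exp (-n) = Real.exp (n ^ 2 / 2 - n) * Real.exp (-(n ^ 2 / 2)) := by
    rw [← Real.exp_add]; ring_nf
  rw [h3]
  nlinarith [Real.exp_pos (-(n ^ 2 / 2))]

/-- The union bound beats the number of net points. -/
theorem union_bound_le_exp {n m D k : ℕ} {L : ℕ} (hD : 1 ≤ D) (hk : 0 < k) (hkn : k ≤ n)
    (hmn : m ≤ n) (hDn : D ≤ n) (hL : 2 * L + 1 ≤ n ^ (6 * D))
    (hK : 8 * D * (6 * D * D ^ D + 2 * D + 1) ≤ k) {x : ℝ} (hx : 2 * D + 4 ≤ x)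
    (hxn : x ^ (4 * D) = n) :
    (m : ℝ) ^ D * (((2 * L + 1) ^ (D ^ D) : ℕ) * (D * (k : ℝ) ^ D * ((2 * D + 4) / x ^ 2) ^ k)) ≤
      Real.exp (-(k / 2)) := by
  have hD' : (1 : ℝ) ≤ D := by exact_mod_cast hD
  have hx0 : 0 < x := by linarith
  -- `E` is the exponent of `n` bounding the net, the tuples `I` and the prefactor `D * k ^ D`; in
  -- powers of `x` this is `4 * D * E`, at most `k / 2`.
  set E := 6 * D * D ^ D + 2 * D + 1 with hE
  have hq : (2 * D + 4) / x ^ 2 ≤ 1 / x := by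
    rw [div_le_div_iff₀ (by positivity) hx0]
    nlinarith
  have hLn : (((2 * L + 1) ^ (D ^ D) : ℕ) : ℝ) ≤ (n : ℝ) ^ (6 * D * D ^ D) := by
    rw [pow_mul]
    exact_mod_cast Nat.pow_le_pow_left hL _
  have hnD : (D : ℝ) ≤ n := by exact_mod_cast hDn
  have hnk : (k : ℝ) ≤ n := by exact_mod_cast hkn
  have hnm : (m : ℝ) ≤ n := by exact_mod_cast hmn
  have hexp : Real.exp 1 ≤ x := by linarith [Real.exp_one_lt_d9]
  calc _ ≤ (n : ℝ) ^ D * ((n : ℝ) ^ (6 * D * D ^ D) * (n * (n : ℝ) ^ D * (1 / x) ^ k)) := by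
        gcongr
    _ = (n : ℝ) ^ E * (1 / x) ^ k := by rw [hE]; ring
    _ = x ^ (4 * D * E) * (1 / x) ^ k := by rw [← hxn, ← pow_mul]
    _ = (1 / x) ^ (k - 4 * D * E) := by
        have hle : 4 * D * E ≤ k := by nlinarith
        have : k = 4 * D * E + (k - 4 * D * E) := by omega
        conv_lhs => rw [this, pow_add, ← mul_assoc, ← mul_pow]
        rw [mul_one_div_cancel hx0.ne', one_pow, one_mul]
    _ ≤ (1 / Real.exp 1) ^ (k - 4 * D * E) := by gcongr
    _ = Real.exp (-((k - 4 * D * E : ℕ) : ℝ)) := by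
        rw [one_div, ← Real.exp_neg, ← Real.exp_nat_mul]; ring_nf
    _ ≤ _ := by
        rw [Real.exp_le_exp, neg_le_neg_iff]
        have h1 : k ≤ 2 * (k - 4 * D * E) := by
          have : 2 * (4 * D * E) ≤ k := by nlinarith
          omega
        have h2 : (k : ℝ) ≤ 2 * ((k - 4 * D * E : ℕ) : ℝ) := by exact_mod_cast h1
        linarith

theorem one_sub_exp_le_gaussianNoise_sigma {n m e k : ℕ} (hm : 0 < m) (hmn : m ≤ n) (hk : 0 < k)
    (hkn : k ≤ n)
    (hn : 2 * (e + 2) * (e + 1) * 2 ^ (e + 1) + (2 * (e + 1) + 4) ^ (4 * (e + 1)) +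
      8 * (e + 1).factorial * (e + 1) ^ (e + 1) + 12 ≤ n)
    (hK : 8 * (e + 1) * (6 * (e + 1) * (e + 1) ^ (e + 1) + 2 * (e + 1) + 1) ≤ k)
    {ρ : ℝ} (hρ : 0 < ρ) (U : Matrix (Fin n) (Fin m) ℝ)
    {Φ : SymTensor n (e + 1) →ₗ[ℝ] SymTensor n (e + 1)} (hΦ : Φ.IsSymmetricProjection)
    (hW : 3 ^ (e + 1) * k * n ^ (e + 1) + n * ((m + m) * n ^ e) ≤
      n * Module.finrank ℝ (LinearMap.range Φ)) :
    1 - (Real.exp (-(k / 2)) + Real.exp (-n) / 2) ≤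
      (gaussianNoise n m ρ).real
        {Z | ρ ^ (e + 1) / (n : ℝ) ^ (5 * (e + 1)) ≤
          sigma ((m + (e + 1) - 1).choose (e + 1))
            (Φ ∘ₗ symKronecker (e + 1) (U + Matrix.of Z))} := by
  have hn0 : 0 < n := by omega
  have hnR : (0 : ℝ) < n := by exact_mod_cast hn0
  have hn1 : (1 : ℝ) ≤ n := by exact_mod_cast hn0
  set F := (e + 1).factorial with hF
  have hF0 : 0 < F := Nat.factorial_pos _
  have hFR : (0 : ℝ) < F := by exact_mod_cast hF0
  set Q := (e + 1) ^ (e + 1) with hQ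
  have hQ0 : 0 < Q := by positivity
  have hQR : (0 : ℝ) < Q := by exact_mod_cast hQ0
  have hnA : 2 * (e + 2) * (e + 1) * 2 ^ (e + 1) ≤ n := by omega
  have heN : e + 1 ≤ n := by
    refine le_trans ?_ hnA
    calc e + 1 = 1 * (e + 1) * 1 := by ring
      _ ≤ _ := Nat.mul_le_mul (Nat.mul_le_mul_right _ (by omega)) Nat.one_le_two_pow
  have hnB : (2 * (e + 1) + 4) ^ (4 * (e + 1)) ≤ n := by omega
  have hnC : 8 * F * Q + 1 ≤ n := by omega
  -- With `r = x ^ 2` the interpolation loss `(2 * r * r) ^ (e + 1)` is `2 ^ (e + 1) * n`, while the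
  -- gain per step is at most `1 / x`.
  set x : ℝ := (n : ℝ) ^ ((1 : ℝ) / ((4 * (e + 1) : ℕ) : ℝ)) with hx
  have hx0 : 0 < x := Real.rpow_pos_of_pos hnR _
  have hxn : x ^ (4 * (e + 1)) = n := by
    rw [hx, one_div]
    exact Real.rpow_inv_natCast_pow hnR.le (by omega)
  have hxD : 2 * ((e + 1 : ℕ) : ℝ) + 4 ≤ x := by
    refine le_of_pow_le_pow_left₀ (n := 4 * (e + 1)) (by omega) hx0.le ?_
    rw [hxn]
    exact_mod_cast hnB
  have hx1 : 1 ≤ x := by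
    have : (0 : ℝ) ≤ ((e + 1 : ℕ) : ℝ) := Nat.cast_nonneg _
    linarith
  set η : ℝ := 1 / (n : ℝ) ^ 3 with hη
  have hη0 : 0 < η := by positivity
  -- Chosen so that, with entries at most `n`, the rounding error is exactly `η ^ (e + 1) / 4`; the
  -- choice of `t` below contributes the other quarter.
  set L := 4 * F * Q * n ^ (5 * (e + 1)) with hL
  have hL0 : 0 < L := by positivity
  have hLn : 2 * L + 1 ≤ n ^ (6 * (e + 1)) := by
    have h1 : 1 ≤ n ^ (5 * (e + 1)) := Nat.one_le_pow _ _ hn0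
    have h2 : n ≤ n ^ (e + 1) := Nat.le_self_pow (by omega) n
    calc 2 * L + 1 ≤ (8 * F * Q + 1) * n ^ (5 * (e + 1)) := by rw [hL]; nlinarith
      _ ≤ n ^ (e + 1) * n ^ (5 * (e + 1)) := Nat.mul_le_mul_right _ (hnC.trans h2)
      _ = n ^ (6 * (e + 1)) := by rw [← pow_add]; congr 1; ring
  have hηpow : η ^ (e + 1) = 1 / (n : ℝ) ^ (3 * (e + 1)) := by
    rw [hη, div_pow, one_pow, ← pow_mul]
  set t := ρ ^ (e + 1) * (η ^ (e + 1) / (4 * F)) with ht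
  have hmain := one_sub_le_gaussianNoise_sigma hm U hΦ (ρ := ρ)
    (t' := ρ ^ (e + 1) / (n : ℝ) ^ (5 * (e + 1))) (t := t) (P := ((2 * L + 1) ^ Q : ℕ) *
        ((e + 1 : ℕ) * (k : ℝ) ^ (e + 1) * ((2 * (e + 1 : ℕ) + 4) / x ^ 2) ^ k)) ?_ ?_
  · refine le_trans ?_ hmain
    have h1 := union_bound_le_exp (L := L) (Nat.le_add_left 1 e) hk hkn hmn
      heN hLn hK hxD hxn
    have h2 := mul_exp_neg_sq_le (n := n) (by exact_mod_cast (by omega : 12 ≤ n))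
    have h3 : (n : ℝ) * m * (2 * Real.exp (-((n : ℝ) ^ 2 / 2))) ≤
        n * n * (2 * Real.exp (-((n : ℝ) ^ 2 / 2))) := by
      have : (m : ℝ) ≤ n := by exact_mod_cast hmn
      gcongr
    linarith
  · have hmn' : (m : ℝ) ≤ n := by exact_mod_cast hmn
    have h4F : (4 * F : ℝ) ≤ (n : ℝ) ^ (e + 1) := by
      have h1 : 4 * F ≤ n := by nlinarith
      have h2 : n ≤ n ^ (e + 1) := Nat.le_self_pow (by omega) n
      exact_mod_cast h1.trans h2
    calc ρ ^ (e + 1) / (n : ℝ) ^ (5 * (e + 1)) * (m : ℝ) ^ (e + 1)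
        ≤ ρ ^ (e + 1) / (n : ℝ) ^ (5 * (e + 1)) * (n : ℝ) ^ (e + 1) := by gcongr
      _ = ρ ^ (e + 1) * (1 / (n : ℝ) ^ (3 * (e + 1)) / (n : ℝ) ^ (e + 1)) := by
          have : (n : ℝ) ^ (5 * (e + 1)) =
              (n : ℝ) ^ (3 * (e + 1)) * (n : ℝ) ^ (e + 1) * (n : ℝ) ^ (e + 1) := by
            rw [← pow_add, ← pow_add]; congr 1; ring
          rw [this]
          field_simp
      _ ≤ t := by
          rw [ht, hηpow]
          gcongr
  · intro I
    refine nearDependentSet_real_le hn0 hk hL0 (by nlinarith) hη0 (by nlinarith) ?_ hρ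
      (Nat.cast_nonneg n) ?_ _ hW _ I
    · have h1 : (2 * x ^ 2 * x ^ 2) ^ (e + 1) = 2 ^ (e + 1) * (n : ℝ) := by
        rw [← hxn, pow_mul x 4, ← mul_pow]; congr 1; ring
      rw [h1, hη]
      have h2 : (2 * (e + 2) * (e + 1) * 2 ^ (e + 1) : ℝ) ≤ n := by exact_mod_cast hnA
      rw [div_mul_eq_mul_div, one_mul, div_le_div_iff₀ (by positivity) (by positivity)]
      push_cast
      calc _ = (2 * (e + 2) * (e + 1) * 2 ^ (e + 1) : ℝ) * (n : ℝ) ^ 2 := by ring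
        _ ≤ n * (n : ℝ) ^ 2 := by gcongr
        _ = _ := by ring
    · have h1 : t / ρ ^ (e + 1) = η ^ (e + 1) / (4 * F) := by
        rw [ht]; field_simp
      have h2 : ((n : ℝ) * n) ^ (e + 1) / (L : ℝ) = η ^ (e + 1) / (4 * F * Q) := by
        rw [hηpow, hL]
        push_cast
        have : (n : ℝ) ^ (5 * (e + 1)) = (n : ℝ) ^ (3 * (e + 1)) * ((n : ℝ) * n) ^ (e + 1) := by
          rw [← sq, ← pow_mul, ← pow_add]; congr 1; ring
        rw [this]
        field_simp
      rw [h1, h2, ← hF, ← hQ]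
      refine le_of_eq ?_
      field_simp
      norm_num

theorem theorem5p1 :
    ∃ C₀ : ℕ, ∀ d : ℕ, 1 ≤ d →
      ∃ c : ℝ, 0 < c ∧ ∀ δ : ℝ, 0 < δ →
        ∃ κ : ℝ, 0 < κ ∧
          ∀ (n m : ℕ) (ρ : ℝ) (U : Matrix (Fin n) (Fin m) ℝ)
            (Φ : SymTensor n d →ₗ[ℝ] SymTensor n d),
            1 ≤ m → (m : ℝ) ≤ c * δ * n → 0 < ρ →
            Φ.IsSymmetricProjection →
            δ * ((n + d - 1).choose d : ℝ) ≤ (Module.finrank ℝ (LinearMap.range Φ) : ℝ) →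
            1 - Real.exp (-(κ * n)) ≤
              (gaussianNoise n m ρ).real
                {Z | ρ ^ d / (n : ℝ) ^ (C₀ * d) ≤
                  sigma ((m + d - 1).choose d) (Φ ∘ₗ symKronecker d (U + Matrix.of Z))} := by
  refine ⟨5, fun d hd => ?_⟩
  obtain ⟨e, rfl⟩ : ∃ e, d = e + 1 := ⟨d - 1, by omega⟩
  obtain ⟨N, hN⟩ : ∃ N, N = 2 * (e + 2) * (e + 1) * 2 ^ (e + 1) +
      (2 * (e + 1) + 4) ^ (4 * (e + 1)) + 8 * (e + 1).factorial * (e + 1) ^ (e + 1) + 12 :=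
    ⟨_, rfl⟩
  obtain ⟨K, hK⟩ : ∃ K, K = 8 * (e + 1) * (6 * (e + 1) * (e + 1) ^ (e + 1) + 2 * (e + 1) + 1) :=
    ⟨_, rfl⟩
  have hK8 : 8 ≤ K := by
    rw [hK]
    calc 8 = 8 * 1 * 1 := rfl
      _ ≤ _ := Nat.mul_le_mul (Nat.mul_le_mul_left _ (by omega)) (Nat.le_add_left _ _)
  have hKR : (8 : ℝ) ≤ K := by exact_mod_cast hK8
  have hNR : (12 : ℝ) ≤ N := by exact_mod_cast (by omega : 12 ≤ N)
  set F : ℝ := ((e + 1).factorial : ℝ) with hF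
  have hF1 : 1 ≤ F := by rw [hF]; exact_mod_cast Nat.factorial_pos _
  -- Half of the rank bound pays for `k ≈ c' δ n` anticoncentration steps, the other half for the
  -- contraction conditions.
  set c' : ℝ := 1 / (2 * 3 ^ (e + 1) * F) with hc'
  have hc'0 : 0 < c' := by positivity
  -- The three terms give, in order, `m ≤ n` together with the contraction budget, `k ≥ K`, and `n ≥
  -- N`. The last two use `1 ≤ m ≤ c δ n`, which excludes small `n`.
  set c : ℝ := min (1 / (4 * F)) (min (c' / K) (1 / (F * N))) with hc
  have hc0 : 0 < c := by
    refine lt_min (by positivity) (lt_min (by positivity) (by positivity))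
  have hc1 : c * (4 * F) ≤ 1 := (le_div_iff₀ (by positivity)).1 (min_le_left _ _)
  have hc2 : c * K ≤ c' :=
    (le_div_iff₀ (by positivity)).1 ((min_le_right _ _).trans (min_le_left _ _))
  have hc3 : c * (F * N) ≤ 1 :=
    (le_div_iff₀ (by positivity)).1 ((min_le_right _ _).trans (min_le_right _ _))
  refine ⟨c, hc0, fun δ hδ => ⟨min (c' * δ / 8) 1, by positivity, ?_⟩⟩
  intro n m ρ U Φ hm hmc hρ hΦ hrank
  have hmR : (1 : ℝ) ≤ m := by exact_mod_cast hm
  have hcn : 1 ≤ c * δ * n := hmR.trans hmc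
  have hn0 : 0 < n := by
    rcases Nat.eq_zero_or_pos n with rfl | h
    · simp at hcn; linarith
    · exact h
  have hnR : (0 : ℝ) < n := by exact_mod_cast hn0
  have hchoose : (n : ℝ) ^ (e + 1) ≤ F * ((n + (e + 1) - 1).choose (e + 1) : ℝ) := by
    rw [hF]
    exact_mod_cast pow_le_factorial_mul_choose n (e + 1)
  have hrank' : δ * (n : ℝ) ^ (e + 1) ≤ F * Module.finrank ℝ (LinearMap.range Φ) := by
    calc δ * (n : ℝ) ^ (e + 1) ≤ δ * (F * ((n + (e + 1) - 1).choose (e + 1) : ℝ)) := by gcongr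
      _ = F * (δ * ((n + (e + 1) - 1).choose (e + 1) : ℝ)) := by ring
      _ ≤ _ := by gcongr
  have hδF : δ ≤ F := by
    have h1 : (Module.finrank ℝ (LinearMap.range Φ) : ℝ) ≤ (n : ℝ) ^ (e + 1) := by
      exact_mod_cast (Submodule.finrank_le _).trans (finrank_symTensor_le n (e + 1))
    have h2 : δ * (n : ℝ) ^ (e + 1) ≤ F * (n : ℝ) ^ (e + 1) := hrank'.trans (by gcongr)
    exact le_of_mul_le_mul_right h2 (by positivity)
  have hNn : N ≤ n := by
    have : (N : ℝ) ≤ n := by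
      calc (N : ℝ) = N * 1 := (mul_one _).symm
        _ ≤ N * (c * F * n) := by
            gcongr
            exact hcn.trans (by gcongr)
        _ = c * (F * N) * n := by ring
        _ ≤ 1 * n := by gcongr
        _ = n := one_mul _
    exact_mod_cast this
  have hKn : (K : ℝ) ≤ c' * δ * n := by
    calc (K : ℝ) = K * 1 := (mul_one _).symm
      _ ≤ K * (c * δ * n) := by gcongr
      _ = c * K * (δ * n) := by ring
      _ ≤ c' * (δ * n) := by gcongr
      _ = _ := by ring
  have hmn : m ≤ n := by
    have : (m : ℝ) ≤ n := by
      calc (m : ℝ) ≤ c * δ * n := hmc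
        _ ≤ c * (4 * F) * n := by
            gcongr
            linarith
        _ ≤ 1 * n := by gcongr
        _ = n := one_mul _
    exact_mod_cast this
  have hc'F : c' * F ≤ 1 := by
    rw [hc', div_mul_eq_mul_div, one_mul, div_le_one (by positivity)]
    have : (1 : ℝ) ≤ 2 * 3 ^ (e + 1) := by
      have : (1 : ℝ) ≤ 3 ^ (e + 1) := one_le_pow₀ (by norm_num)
      linarith
    exact le_mul_of_one_le_left (by positivity) this
  set k := ⌊c' * δ * n⌋₊ with hk
  have hk1 : (k : ℝ) ≤ c' * δ * n := Nat.floor_le (by positivity)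
  have hk2 : c' * δ * n < k + 1 := Nat.lt_floor_add_one _
  have hKk : K ≤ k := Nat.le_floor hKn
  have hkn : k ≤ n := by
    have : (k : ℝ) ≤ n := by
      calc (k : ℝ) ≤ c' * δ * n := hk1
        _ ≤ c' * F * n := by gcongr
        _ ≤ 1 * n := by gcongr
        _ = n := one_mul _
    exact_mod_cast this
  have hW : 3 ^ (e + 1) * k * n ^ (e + 1) + n * ((m + m) * n ^ e) ≤
      n * Module.finrank ℝ (LinearMap.range Φ) := by
    have h1 : (3 : ℝ) ^ (e + 1) * c' * F = 1 / 2 := by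
      rw [hc']; field_simp
    have h2 : F * ((3 : ℝ) ^ (e + 1) * k * n ^ (e + 1) + n * ((m + m) * n ^ e)) ≤
        F * (n * Module.finrank ℝ (LinearMap.range Φ)) := by
      calc _ ≤ F * ((3 : ℝ) ^ (e + 1) * (c' * δ * n) * n ^ (e + 1) +
            n * ((c * δ * n + c * δ * n) * n ^ e)) := by gcongr
        _ = ((3 : ℝ) ^ (e + 1) * c' * F + c * (4 * F) / 2) * (n * (δ * (n : ℝ) ^ (e + 1))) := by
            ring
        _ ≤ (1 / 2 + 1 / 2) * (n * (δ * (n : ℝ) ^ (e + 1))) := by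
            rw [h1]; gcongr
        _ = n * (δ * (n : ℝ) ^ (e + 1)) := by ring
        _ ≤ n * (F * Module.finrank ℝ (LinearMap.range Φ)) := by gcongr
        _ = _ := by ring
    exact_mod_cast le_of_mul_le_mul_left h2 (by linarith)
  have hmain := one_sub_exp_le_gaussianNoise_sigma hm hmn (by omega) hkn (hN ▸ hNn) (hK ▸ hKk) hρ U
    hΦ hW
  refine le_trans ?_ hmain
  set κ := min (c' * δ / 8) 1 with hκ
  have h1 : Real.exp (-n) ≤ Real.exp (-(κ * n)) := by
    rw [Real.exp_le_exp, neg_le_neg_iff]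
    calc κ * n ≤ 1 * n := by gcongr; exact min_le_right _ _
      _ = n := one_mul _
  -- Since `k ≥ 8`, passing from `k / 2` to `κ n ≤ c' δ n / 8` leaves room for an extra `exp (-1) ≤
  -- 1/2`.
  have h2 : Real.exp (-(k / 2)) ≤ Real.exp (-(κ * n)) / 2 := by
    have h3 : -((k : ℝ) / 2) ≤ -1 + -(κ * n) := by
      have : κ * n ≤ c' * δ / 8 * n := by gcongr; exact min_le_left _ _
      linarith
    refine (Real.exp_le_exp.2 h3).trans ?_
    rw [Real.exp_add]
    have h4 : Real.exp (-1) ≤ 1 / 2 := by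
      rw [Real.exp_neg, one_div]
      exact inv_anti₀ (by norm_num) (by linarith [Real.exp_one_gt_d9])
    nlinarith [Real.exp_pos (-(κ * n))]
  linarith
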